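/- Let $(\Omega,m)$ be a measure space (for example a $\sigma$-finite or a localizable one; neither is needed). Let $T$ and $T_0$ be positive $C_0$-semigroups on the real Hilbert lattice $L_2(m)$, i.e. $0\le u$ implies $0\le T(t)u$ and $0\le T_0(t)u$ for all $t\ge 0$. Let $A$ and $A_0$ be their generators, $\varrho(A),\varrho(A_0)$ the resolvent sets, and $A_0^*$, $T_0(t)^*$ the Hilbert space adjoints. Assume that there are $M\ge 1$ and $\omega\in\mathbb R$ such that for all $t\ge 0$ the operators $T(t)$ and $T_0(t)^*$ map $L_2(m)\cap L_1(m)$ into $L_1(m)$ and $$\|T(t)u\|_1\le Me^{\omega t}\|u\|_1,\qquad \|T_0(t)^*v\|_1\le Me^{\omega t}\|v\|_1\qquad (u,v\in L_2(m)\cap L_1(m)).$$ For $C\in\mathbb R$ consider the following statements. (a)$_C$ For all $t\ge 0$ and all $0\le u\in L_2(m)\cap L_1(m)$, $$T(t)u\le T_0(t)u+C\,t\,e^{\omega t}\|u\|_1\mathbf 1_\Omega\quad m\text{-a.e.}$$ (b)$_C$ For all $0\le u\in D(A)\cap L_1(m)$ and all $0\le v\in D(A_0^*)\cap L_1(m)$,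 $$\langle Au,v\rangle\le\langle u,A_0^*v\rangle+C\|u\|_1\|v\|_1 .$$ (c)$_C$ For all real $\lambda>\omega$ with $[\lambda,\infty)\subseteq\varrho(A)\cap\varrho(A_0)$ and all $0\le u\in L_2(m)\cap L_1(m)$, $$(\lambda-A)^{-1}u\le(\lambda-A_0)^{-1}u+\frac{C}{(\lambda-\omega)^2}\|u\|_1\mathbf 1_\Omega\quad m\text{-a.e.}$$ (If $T$ and $T_0$ are also $O(e^{\omega t})$ in operator norm on $L_2(m)$, these are all $\lambda>\omega$.) Then the following are equivalent: there is $C_1\in\mathbb R$ with (a)$_{C_1}$; there is $C_2\in\mathbb R$ with (b)$_{C_2}$; there is $C_3\in\mathbb R$ with (c)$_{C_3}$. Moreover, (a)$_C$ implies (b)$_C$ for every $C\in\mathbb R$, and for every $C\ge 0$, (b)$_C$ implies (c)$_{CM^2}$ and (c)$_C$ implies (a)$_{CM^2}$. -/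

import Mathlib

open MeasureTheory Filter Topology
open scoped NNReal InnerProductSpace

/-- A strongly continuous (`C₀`-) semigroup of bounded linear operators on a real normed space. -/
structure C0Semigroup (E : Type*) [NormedAddCommGroup E] [NormedSpace ℝ E] where
  /-- The operator at time `t ≥ 0`. -/
  op : ℝ≥0 → E →L[ℝ] E
  op_zero : op 0 = ContinuousLinearMap.id ℝ E
  op_add : ∀ s t : ℝ≥0, op (s + t) = (op s).comp (op t)
  tendsto_zero : ∀ u : E, Tendsto (fun t : ℝ≥0 => op t u) (𝓝 0) (𝓝 u)

namespace C0Semigroup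

variable {E : Type*} [NormedAddCommGroup E] [NormedSpace ℝ E]

/-- The difference quotient `t⁻¹ (T(t) u - u)`. -/
noncomputable def quot (T : C0Semigroup E) (u : E) (t : ℝ≥0) : E :=
  (t : ℝ)⁻¹ • (T.op t u - u)

/-- The domain of the generator: those `u` for which `t⁻¹ (T(t) u - u)` converges in norm
as `t` decreases to `0`. -/
def generatorDomain (T : C0Semigroup E) : Submodule ℝ E where
  carrier := {u | ∃ w : E, Tendsto (T.quot u) (𝓝[>] 0) (𝓝 w)}
  zero_mem' := by
    refine ⟨0, ?_⟩
    have h : T.quot 0 = fun _ => 0 := by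
      funext t
      simp [quot]
    rw [h]
    exact tendsto_const_nhds
  add_mem' := by
    rintro u v ⟨w, hw⟩ ⟨z, hz⟩
    refine ⟨w + z, ?_⟩
    have h : T.quot (u + v) = fun t => T.quot u t + T.quot v t := by
      funext t
      simp only [quot, map_add, ← smul_add]
      congr 1
      abel
    rw [h]
    exact hw.add hz
  smul_mem' := by
    rintro c u ⟨w, hw⟩
    refine ⟨c • w, ?_⟩
    have h : T.quot (c • u) = fun t => c • T.quot u t := by
      funext t
      simp only [quot, map_smul, ← smul_sub, smul_comm c]
    rw [h]
    exact hw.const_smul c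

/-- The generator `A` of a `C₀`-semigroup `T`, as an unbounded operator:
`A u = lim_{t ↓ 0} t⁻¹ (T(t) u - u)` on the set of all `u` for which the limit exists. -/
noncomputable def generator (T : C0Semigroup E) : E →ₗ.[ℝ] E where
  domain := T.generatorDomain
  toFun :=
    { toFun := fun u => Classical.choose u.2
      map_add' := by
        intro u v
        refine tendsto_nhds_unique (Classical.choose_spec (u + v).2) ?_
        have h : T.quot ((u + v : T.generatorDomain) : E)
            = fun t => T.quot (u : E) t + T.quot (v : E) t := by
          funext t
          simp only [quot, Submodule.coe_add, map_add, ← smul_add]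
          congr 1
          abel
        rw [h]
        exact (Classical.choose_spec u.2).add (Classical.choose_spec v.2)
      map_smul' := by
        intro c u
        refine tendsto_nhds_unique (Classical.choose_spec (c • u).2) ?_
        have h : T.quot ((c • u : T.generatorDomain) : E) = fun t => c • T.quot (u : E) t := by
          funext t
          simp only [quot, Submodule.coe_smul, map_smul, ← smul_sub, smul_comm c]
        rw [h]
        exact (Classical.choose_spec u.2).const_smul c }

theorem tendsto_generator (T : C0Semigroup E) (u : T.generator.domain) :
    Tendsto (fun t : ℝ≥0 => (t : ℝ)⁻¹ • (T.op t (u : E) - u)) (𝓝[>] 0) (𝓝 (T.generator u)) :=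
  Classical.choose_spec u.2

end C0Semigroup

namespace LinearPMap

variable {E : Type*} [NormedAddCommGroup E] [NormedSpace ℝ E]

/-- `R` is the resolvent `(μ - A)⁻¹`: a bounded, everywhere defined, two-sided inverse of
`μ - A : D(A) → E`. -/
def IsResolventAt (A : E →ₗ.[ℝ] E) (μ : ℝ) (R : E →L[ℝ] E) : Prop :=
  (∀ y : E, ∃ h : R y ∈ A.domain, μ • R y - A ⟨R y, h⟩ = y) ∧
    ∀ x : A.domain, R (μ • (x : E) - A x) = x

/-- The (real part of the) resolvent set `ρ(A)` of an unbounded operator. -/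
def realResolventSet (A : E →ₗ.[ℝ] E) : Set ℝ :=
  {μ | ∃ R : E →L[ℝ] E, A.IsResolventAt μ R}

open Classical in
/-- The resolvent `(μ - A)⁻¹`; it is only meaningful for `μ ∈ ρ(A)`. -/
noncomputable def resolventOp (A : E →ₗ.[ℝ] E) (μ : ℝ) : E →L[ℝ] E :=
  if h : μ ∈ A.realResolventSet then Classical.choose h else 0

theorem resolventOp_spec (A : E →ₗ.[ℝ] E) {μ : ℝ} (h : μ ∈ A.realResolventSet) :
    A.IsResolventAt μ (A.resolventOp μ) := by
  rw [resolventOp, dif_pos h]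
  exact Classical.choose_spec h

theorem IsResolventAt.unique {A : E →ₗ.[ℝ] E} {μ : ℝ} {R S : E →L[ℝ] E}
    (hR : A.IsResolventAt μ R) (hS : A.IsResolventAt μ S) : R = S := by
  ext y
  obtain ⟨h, hy⟩ := hS.1 y
  have := hR.2 ⟨S y, h⟩
  simpa [hy] using this

end LinearPMap

section L2

variable {Ω : Type*} [MeasurableSpace Ω] {m : Measure Ω}

/-- The `L₁`-norm `‖u‖₁ = ∫ |u| dm`, used for functions that are known to lie in `L₁(m)`. -/
noncomputable def l1Norm (u : Lp ℝ 2 m) : ℝ := ∫ x, |u x| ∂m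

/-- Positivity of a semigroup on `L₂(m)`: `0 ≤ u` implies `0 ≤ T(t) u` for all `t ≥ 0`. -/
def C0Semigroup.IsPositive (T : C0Semigroup (Lp ℝ 2 m)) : Prop :=
  ∀ (t : ℝ≥0) (u : Lp ℝ 2 m), 0 ≤ u → 0 ≤ T.op t u

/-- A family of operators on `L₂(m)` is exponentially bounded on `L₁`: every `S(t)` maps
`L₂(m) ∩ L₁(m)` into `L₁(m)`, and `‖S(t) u‖₁ ≤ M e^{ω t} ‖u‖₁` there. -/
def ExpBoundedOnL1 (S : ℝ≥0 → Lp ℝ 2 m →L[ℝ] Lp ℝ 2 m) (M ω : ℝ) : Prop :=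
  ∀ (t : ℝ≥0) (u : Lp ℝ 2 m), Integrable u m →
    Integrable (S t u) m ∧ l1Norm (S t u) ≤ M * Real.exp (ω * t) * l1Norm u

/-- `T(t) u ≤ T₀(t) u + C t e^{ω t} ‖u‖₁ 𝟙` for `t ≥ 0` and `0 ≤ u ∈ L₂(m) ∩ L₁(m)`. -/
def SemigroupBound (T T₀ : C0Semigroup (Lp ℝ 2 m)) (ω C : ℝ) : Prop :=
  ∀ (t : ℝ≥0) (u : Lp ℝ 2 m), 0 ≤ u → Integrable u m →
    ∀ᵐ x ∂m, T.op t u x ≤ T₀.op t u x + C * t * Real.exp (ω * t) * l1Norm u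

/-- `⟨A u, v⟩ ≤ ⟨u, A₀* v⟩ + C ‖u‖₁ ‖v‖₁` for `0 ≤ u ∈ D(A) ∩ L₁(m)` and
`0 ≤ v ∈ D(A₀*) ∩ L₁(m)`, where `A` and `A₀` generate `T` and `T₀`. -/
def GeneratorBound (T T₀ : C0Semigroup (Lp ℝ 2 m)) (C : ℝ) : Prop :=
  ∀ (u : T.generator.domain) (v : T₀.generator.adjoint.domain),
    0 ≤ (u : Lp ℝ 2 m) → Integrable (u : Lp ℝ 2 m) m →
    0 ≤ (v : Lp ℝ 2 m) → Integrable (v : Lp ℝ 2 m) m →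
    ⟪T.generator u, (v : Lp ℝ 2 m)⟫_ℝ ≤
      ⟪(u : Lp ℝ 2 m), T₀.generator.adjoint v⟫_ℝ
        + C * l1Norm (u : Lp ℝ 2 m) * l1Norm (v : Lp ℝ 2 m)

/-- `(μ - A)⁻¹ u ≤ (μ - A₀)⁻¹ u + C (μ - ω)⁻² ‖u‖₁ 𝟙` for `0 ≤ u ∈ L₂(m) ∩ L₁(m)` and all
`μ > ω` with `[μ, ∞) ⊆ ρ(A) ∩ ρ(A₀)`. The last condition makes the (positive) resolvents on `L₂(m)`
available; it holds for every `μ > ω` if `ω` also bounds the exponential growth of `T` and `T₀`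
on `L₂(m)`. -/
def ResolventBound (T T₀ : C0Semigroup (Lp ℝ 2 m)) (ω C : ℝ) : Prop :=
  ∀ μ : ℝ, ω < μ →
    Set.Ici μ ⊆ T.generator.realResolventSet ∩ T₀.generator.realResolventSet →
    ∀ u : Lp ℝ 2 m, 0 ≤ u → Integrable u m →
      ∀ᵐ x ∂m, T.generator.resolventOp μ u x ≤
        T₀.generator.resolventOp μ u x + C / (μ - ω) ^ 2 * l1Norm u

end L2

/-! Write R = (μ - A)⁻¹ and S = (μ - A₀)⁻¹. Statement (a) yields (b) by pairing with v and
differentiating at t = 0. For (b) to (c), insert Ru and S*v: the terms with μ cancel, ⟨Ru - Su, v⟩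
remains, and each L₁ norm costs a factor M/(μ - ω). For (c) to (a), telescope Rⁿ - Sⁿ into the terms
S^(n-1-k) (R - S) R^k. The L₁ bounds for R^k and (S^(n-1-k))* carry one factor M each, so the sum is
at most n C M² ‖u‖₁ ‖v‖₁ / (μ - ω)^(n+1); with μ = n/t the exponential formula
`tendsto_resolventOp_pow` turns this into C M² t e^{ωt} ‖u‖₁ ‖v‖₁.

The delicate point is that ω controls growth in L₁ only, so for μ > ω the Laplace integral of T need
not converge in L₂. Resolvents are reached instead through `OrbitBound`, the scalar inequality
φ(T(t)b) ≤ c e^{ωt} for all t. By `OrbitBound.resolventOp`, Rb inherits it with c/(μ - ω): for large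
μ by a contraction built on a Laplace integral over [0, 1], then downwards along ρ(A) by the
resolvent identity. Iteration costs no further constant. Different φ give positivity, the L₁ bounds
(also for adjoints) and the Hille–Yosida estimate behind the exponential formula.

Pointwise inequalities are tested on indicators of sets of finite measure. This suffices on any
measure space, since an L₂ function has superlevel sets of finite measure at positive heights. -/

namespace C0Semigroup

/-! ### Elementary semigroup theory: domain, growth bound, strong continuity. -/

section Basic

variable {E : Type*} [NormedAddCommGroup E] [NormedSpace ℝ E] (T : C0Semigroup E)

theorem op_zero_apply (u : E) : T.op 0 u = u := by
  rw [T.op_zero]; rfl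

theorem op_add_apply (s t : ℝ≥0) (u : E) : T.op (s + t) u = T.op s (T.op t u) := by
  rw [T.op_add]; rfl

theorem op_comm_apply (s t : ℝ≥0) (u : E) : T.op s (T.op t u) = T.op t (T.op s u) := by
  rw [← op_add_apply, ← op_add_apply, add_comm]

theorem op_pow (t : ℝ≥0) (n : ℕ) : T.op t ^ n = T.op (n * t) := by
  induction n with
  | zero => simp [T.op_zero]; rfl
  | succ k ih =>
    rw [pow_succ, ih]
    push_cast
    rw [add_mul, one_mul, T.op_add]; rfl

theorem mem_domain_of_tendsto {x w : E}
    (h : Tendsto (fun t : ℝ≥0 => (t : ℝ)⁻¹ • (T.op t x - x)) (𝓝[>] 0) (𝓝 w)) :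
    ∃ hx : x ∈ T.generator.domain, T.generator ⟨x, hx⟩ = w :=
  ⟨⟨w, h⟩, tendsto_nhds_unique (T.tendsto_generator ⟨x, ⟨w, h⟩⟩) h⟩

theorem tendsto_coe_nhdsGT_zero :
    Tendsto (fun t : ℝ≥0 => (t : ℝ)) (𝓝[>] 0) (𝓝[>] 0) := by
  refine tendsto_nhdsWithin_iff.2 ⟨?_, ?_⟩
  · have : Tendsto (fun t : ℝ≥0 => (t : ℝ)) (𝓝 0) (𝓝 ((0 : ℝ≥0) : ℝ)) :=
      NNReal.continuous_coe.tendsto 0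
    exact this.mono_left nhdsWithin_le_nhds
  · filter_upwards [self_mem_nhdsWithin] with t ht
    exact NNReal.coe_pos.2 ht

/-- If an orbit is given near `0` by a differentiable curve, its starting point is in the domain
of the generator. -/
theorem mem_domain_of_hasDerivAt {x w : E} {ψ : ℝ → E} (hψ : HasDerivAt ψ w 0)
    (h : ∀ t : ℝ≥0, T.op t x = ψ t) :
    ∃ hx : x ∈ T.generator.domain, T.generator ⟨x, hx⟩ = w := by
  apply T.mem_domain_of_tendsto
  have h0 : x = ψ 0 := by simpa [T.op_zero_apply] using h 0
  have := hψ.tendsto_slope_zero_right.comp tendsto_coe_nhdsGT_zero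
  refine this.congr fun t => ?_
  simp [h t, ← h0]

theorem op_mem_domain (t : ℝ≥0) (x : T.generator.domain) :
    ∃ h : T.op t x ∈ T.generator.domain, T.generator ⟨T.op t x, h⟩ = T.op t (T.generator x) := by
  apply T.mem_domain_of_tendsto
  refine (((T.op t).continuous.tendsto _).comp (T.tendsto_generator x)).congr fun s => ?_
  simp [T.op_comm_apply s t]

/-- A bounded operator commuting with the semigroup commutes with its generator. -/
theorem map_mem_domain_of_commute {V : E →L[ℝ] E}
    (hV : ∀ (t : ℝ≥0) (u : E), T.op t (V u) = V (T.op t u)) (x : T.generator.domain) :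
    ∃ h : V x ∈ T.generator.domain, T.generator ⟨V x, h⟩ = V (T.generator x) := by
  apply T.mem_domain_of_tendsto
  refine ((V.continuous.tendsto _).comp (T.tendsto_generator x)).congr fun s => ?_
  simp [hV]

/-- Otherwise some tₙ → 0 has ‖T(tₙ)‖ > n + 1, although T(tₙ)u converges for every u; this
contradicts uniform boundedness. -/
theorem exists_norm_le_near_zero [CompleteSpace E] :
    ∃ δ : ℝ≥0, 0 < δ ∧ ∃ C : ℝ, 1 ≤ C ∧ ∀ t ≤ δ, ‖T.op t‖ ≤ C := by
  by_contra! hcon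
  have hcon' : ∀ n : ℕ, ∃ t : ℝ≥0, t ≤ 1 / ((n : ℝ≥0) + 1) ∧ (n : ℝ) + 1 < ‖T.op t‖ := fun n =>
    hcon (1 / ((n : ℝ≥0) + 1)) (by positivity) ((n : ℝ) + 1) (by simp)
  choose t ht hn using hcon'
  have ht0 : Tendsto t atTop (𝓝 0) :=
    tendsto_of_tendsto_of_tendsto_of_le_of_le tendsto_const_nhds
      tendsto_one_div_add_atTop_nhds_zero_nat (fun _ => zero_le) ht
  obtain ⟨C, hC⟩ := banach_steinhaus (g := fun n => T.op (t n)) fun u => by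
    obtain ⟨C, hC⟩ := (((T.tendsto_zero u).comp ht0).norm).bddAbove_range
    exact ⟨C, fun n => hC ⟨n, rfl⟩⟩
  obtain ⟨n, hnC⟩ := exists_nat_gt C
  linarith [hn n, hC n]

theorem exists_growth_bound [CompleteSpace E] :
    ∃ K β : ℝ, 1 ≤ K ∧ 0 ≤ β ∧ ∀ t : ℝ≥0, ‖T.op t‖ ≤ K * Real.exp (β * t) := by
  obtain ⟨δ, hδ, C, hC, hb⟩ := T.exists_norm_le_near_zero
  have hC0 : 0 < C := by linarith
  have hδ' : (0 : ℝ) < δ := by exact_mod_cast hδ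
  refine ⟨C, Real.log C / δ, hC, div_nonneg (Real.log_nonneg hC) hδ'.le, fun t => ?_⟩
  have key : ∀ (n : ℕ) (r : ℝ≥0), r ≤ δ → ‖T.op (n * δ + r)‖ ≤ C * C ^ n := by
    intro n r hr
    induction n with
    | zero => simpa using hb r hr
    | succ k ih =>
      have : ((k + 1 : ℕ) : ℝ≥0) * δ + r = δ + (k * δ + r) := by push_cast; ring
      rw [this, T.op_add]
      calc _ ≤ ‖T.op δ‖ * ‖T.op (k * δ + r)‖ := ContinuousLinearMap.opNorm_comp_le _ _
        _ ≤ C * (C * C ^ k) := by gcongr; exact hb δ le_rfl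
        _ = _ := by ring
  -- Split t = nδ + r with r ≤ δ; then Cⁿ = exp(n log C) ≤ exp((log C / δ) t).
  set n := ⌊t / δ⌋₊ with hn
  have h1 : (n : ℝ≥0) * δ ≤ t := by
    have := Nat.floor_le (zero_le (a := t / δ))
    rwa [le_div_iff₀ hδ] at this
  have h2 : t ≤ n * δ + δ := by
    have := (Nat.lt_floor_add_one (t / δ)).le
    rw [div_le_iff₀ hδ] at this
    rw [← hn] at this
    calc t ≤ _ := this
      _ = _ := by ring
  have h3 : n * δ + (t - n * δ) = t := add_tsub_cancel_of_le h1
  have h4 := key n (t - n * δ) (tsub_le_iff_left.2 h2)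
  rw [h3] at h4
  refine h4.trans ?_
  gcongr
  rw [← Real.rpow_natCast, Real.rpow_def_of_pos hC0]
  apply Real.exp_le_exp.2
  rw [div_mul_eq_mul_div, le_div_iff₀ hδ', mul_assoc]
  apply mul_le_mul_of_nonneg_left _ (Real.log_nonneg hC)
  exact_mod_cast h1

theorem continuous_op [CompleteSpace E] (u : E) : Continuous fun t : ℝ≥0 => T.op t u := by
  obtain ⟨K, β, hK, hβ, hb⟩ := T.exists_growth_bound
  have key : ∀ s t : ℝ≥0, s ≤ t → ‖T.op t u - T.op s u‖
      ≤ K * Real.exp (β * s) * ‖T.op (t - s) u - u‖ := by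
    intro s t hst
    have : T.op t u = T.op s (T.op (t - s) u) := by
      rw [← T.op_add_apply, add_tsub_cancel_of_le hst]
    rw [this, ← map_sub]
    exact (T.op s).le_of_opNorm_le (hb s) _
  have key' : ∀ s t : ℝ≥0, ‖T.op t u - T.op s u‖
      ≤ K * Real.exp (β * s) * ‖T.op (nndist t s) u - u‖ := by
    have hd : ∀ s t : ℝ≥0, s ≤ t → nndist t s = t - s := by
      intro s t hst
      rw [NNReal.nndist_eq, tsub_eq_zero_of_le hst]; simp
    intro s t
    rcases le_total s t with hst | hst
    · rw [hd s t hst]; exact key s t hst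
    · rw [nndist_comm, hd t s hst, norm_sub_rev]
      refine (key t s hst).trans ?_
      gcongr
  rw [continuous_iff_continuousAt]
  intro s
  rw [ContinuousAt, tendsto_iff_norm_sub_tendsto_zero]
  have hn : Tendsto (fun t : ℝ≥0 => nndist t s) (𝓝 s) (𝓝 0) := by
    have : Continuous fun t : ℝ≥0 => nndist t s := by fun_prop
    simpa using this.tendsto s
  have h1 := ((((T.tendsto_zero u).comp hn).sub_const u).norm).const_mul (K * Real.exp (β * s))
  simp only [sub_self, norm_zero, mul_zero] at h1
  exact squeeze_zero (fun _ => norm_nonneg _) (fun t => key' s t) h1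

/-- The discounted orbit `s ↦ e^{-μ s} T(s) u`. -/
noncomputable def discounted (μ : ℝ) (u : E) (s : ℝ) : E :=
  Real.exp (-μ * s) • T.op s.toNNReal u

theorem op_discounted {t : ℝ≥0} {μ s : ℝ} (hs : 0 ≤ s) (u : E) :
    T.op t (T.discounted μ u s) = Real.exp (μ * t) • T.discounted μ u (s + t) := by
  have h : (s + t).toNNReal = t + s.toNNReal := by
    rw [Real.toNNReal_add hs t.coe_nonneg, Real.toNNReal_coe, add_comm]
  rw [discounted, discounted, map_smul, smul_smul, ← Real.exp_add, h, T.op_add_apply]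
  congr 2
  ring

end Basic

/-! ### Truncated Laplace transforms and the resolvent for large μ. -/

section Laplace

variable {E : Type*} [NormedAddCommGroup E] [NormedSpace ℝ E] [CompleteSpace E]
  (T : C0Semigroup E)

theorem continuous_discounted (μ : ℝ) (u : E) : Continuous (T.discounted μ u) := by
  have := (T.continuous_op u).comp continuous_real_toNNReal
  exact (by fun_prop : Continuous fun s : ℝ => Real.exp (-μ * s)).smul this

/-- The truncated Laplace transform `u ↦ ∫₀^τ e^{-μ s} T(s) u ds`. -/
noncomputable def truncLaplace (μ τ : ℝ) : E →L[ℝ] E :=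
  LinearMap.mkContinuousOfExistsBound
    { toFun := fun u => ∫ s in (0 : ℝ)..τ, T.discounted μ u s
      map_add' := fun u v => by
        rw [← intervalIntegral.integral_add ((T.continuous_discounted μ u).intervalIntegrable _ _)
          ((T.continuous_discounted μ v).intervalIntegrable _ _)]
        simp [discounted]
      map_smul' := fun c u => by
        rw [RingHom.id_apply, ← intervalIntegral.integral_smul]
        simp [discounted, smul_comm c] } (by
    obtain ⟨K, β, hK, hβ, hb⟩ := T.exists_growth_bound
    refine ⟨Real.exp (|μ| * |τ|) * (K * Real.exp (β * |τ|)) * |τ|, fun u => ?_⟩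
    have := intervalIntegral.norm_integral_le_of_norm_le_const (a := (0 : ℝ)) (b := τ)
      (f := T.discounted μ u) (C := Real.exp (|μ| * |τ|) * (K * Real.exp (β * |τ|)) * ‖u‖)
      fun s hs => by
        have hs' : |s| ≤ |τ| := by
          have := Set.uIoc_subset_uIcc hs
          simpa using Set.abs_sub_left_of_mem_uIcc this
        rw [discounted, norm_smul, Real.norm_of_nonneg (Real.exp_pos _).le, mul_assoc]
        have h1 : -μ * s ≤ |μ| * |τ| := by
          calc -μ * s ≤ |-μ * s| := le_abs_self _
            _ = |μ| * |s| := by rw [abs_mul, abs_neg]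
            _ ≤ _ := by gcongr
        have h2 : ((s.toNNReal : ℝ≥0) : ℝ) ≤ |τ| := by
          rw [Real.coe_toNNReal']
          exact max_le ((le_abs_self s).trans hs') (abs_nonneg _)
        gcongr
        refine (T.op s.toNNReal).le_of_opNorm_le ((hb _).trans ?_) u
        gcongr
    simp only [sub_zero] at this
    calc _ ≤ _ := this
      _ = _ := by ring)

theorem truncLaplace_apply (μ τ : ℝ) (u : E) :
    T.truncLaplace μ τ u = ∫ s in (0 : ℝ)..τ, T.discounted μ u s := rfl

theorem op_truncLaplace_eq_integral (t : ℝ≥0) (μ τ : ℝ) (u : E) :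
    T.op t (T.truncLaplace μ τ u) = ∫ s in (0 : ℝ)..τ, T.op t (T.discounted μ u s) :=
  ((T.op t).intervalIntegral_comp_comm
    ((T.continuous_discounted μ u).intervalIntegrable _ _)).symm

theorem op_truncLaplace_comm (t : ℝ≥0) (μ τ : ℝ) (u : E) :
    T.op t (T.truncLaplace μ τ u) = T.truncLaplace μ τ (T.op t u) := by
  rw [op_truncLaplace_eq_integral, truncLaplace_apply]
  congr 1 with s
  simp [discounted, T.op_comm_apply t]

theorem op_truncLaplace (t : ℝ≥0) (μ : ℝ) {τ : ℝ} (hτ : 0 ≤ τ) (u : E) :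
    T.op t (T.truncLaplace μ τ u) = Real.exp (μ * t) •
      (T.truncLaplace μ (τ + t) u - T.truncLaplace μ t u) := by
  rw [op_truncLaplace_eq_integral]
  have : ∫ s in (0 : ℝ)..τ, T.op t (T.discounted μ u s)
      = ∫ s in (0 : ℝ)..τ, Real.exp (μ * t) • T.discounted μ u (s + t) := by
    apply intervalIntegral.integral_congr
    intro s hs
    rw [Set.uIcc_of_le hτ] at hs
    exact T.op_discounted hs.1 u
  rw [this, intervalIntegral.integral_smul, intervalIntegral.integral_comp_add_right,
    truncLaplace_apply, truncLaplace_apply, zero_add,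
    intervalIntegral.integral_interval_sub_left] <;>
  exact (T.continuous_discounted μ u).intervalIntegrable _ _

theorem hasDerivAt_truncLaplace (μ τ : ℝ) (u : E) :
    HasDerivAt (fun τ => T.truncLaplace μ τ u) (T.discounted μ u τ) τ :=
  intervalIntegral.integral_hasDerivAt_right
    ((T.continuous_discounted μ u).intervalIntegrable _ _)
    ((T.continuous_discounted μ u).stronglyMeasurableAtFilter _ _)
    (T.continuous_discounted μ u).continuousAt

/-- Applying T(t) only shifts the window of integration, so the orbit of the integral is an explicit
function of its endpoints, differentiable at t = 0 by the fundamental theorem of calculus. -/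
theorem truncLaplace_mem_domain (μ : ℝ) {τ : ℝ} (hτ : 0 ≤ τ) (u : E) :
    ∃ h : T.truncLaplace μ τ u ∈ T.generator.domain,
      T.generator ⟨T.truncLaplace μ τ u, h⟩
        = μ • T.truncLaplace μ τ u + (T.discounted μ u τ - u) := by
  refine T.mem_domain_of_hasDerivAt (ψ := fun t => Real.exp (μ * t) •
      (T.truncLaplace μ (τ + t) u - T.truncLaplace μ t u)) ?_ fun t => T.op_truncLaplace t μ hτ u
  have h1 : HasDerivAt (fun t : ℝ => Real.exp (μ * t)) μ 0 := by
    simpa using ((hasDerivAt_id (0 : ℝ)).const_mul μ).exp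
  have h2 : HasDerivAt (fun t => T.truncLaplace μ (τ + t) u) (T.discounted μ u τ) 0 :=
    HasDerivAt.comp_const_add τ 0 (by simpa using T.hasDerivAt_truncLaplace μ τ u)
  have h3 : HasDerivAt (fun t => T.truncLaplace μ t u) u 0 := by
    simpa [discounted, T.op_zero_apply] using T.hasDerivAt_truncLaplace μ 0 u
  have h4 := h1.smul (h2.sub h3)
  have h0 : T.truncLaplace μ 0 u = 0 := by simp [truncLaplace_apply]
  simp only [mul_zero, Real.exp_zero, one_smul, add_zero, Pi.sub_apply, h0, sub_zero] at h4
  rw [add_comm]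
  exact h4

theorem dense_domain : Dense (T.generator.domain : Set E) := by
  intro u
  have h3 : HasDerivAt (fun t => T.truncLaplace 0 t u) u 0 := by
    simpa [discounted, T.op_zero_apply] using T.hasDerivAt_truncLaplace 0 0 u
  have h4 := h3.tendsto_slope_zero_right
  refine mem_closure_of_tendsto h4 ?_
  filter_upwards [self_mem_nhdsWithin] with t ht
  have h0 : T.truncLaplace 0 0 u = 0 := by simp [truncLaplace_apply]
  simp only [zero_add, h0, sub_zero]
  exact T.generator.domain.smul_mem _ (T.truncLaplace_mem_domain 0 (le_of_lt ht) u).1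

/-- For `x` in the domain, `∫₀^τ e^{-μ s} T(s) (μ - A) x ds = x - e^{-μ τ} T(τ) x`. -/
theorem truncLaplace_sub_generator (μ : ℝ) {τ : ℝ} (hτ : 0 ≤ τ) (x : T.generator.domain) :
    T.truncLaplace μ τ (μ • (x : E) - T.generator x) = x - T.discounted μ x τ := by
  obtain ⟨h1, h2⟩ := T.truncLaplace_mem_domain μ hτ x
  obtain ⟨h3, h4⟩ := T.map_mem_domain_of_commute (T.op_truncLaplace_comm · μ τ) x
  rw [map_sub, map_smul, ← h4, h2]
  abel

/-- With V the Laplace integral over [0, 1] and Q = e^{-μ}T(1), one has (μ - A)V = 1 - Q, and V(μ -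
A) = 1 - Q on the domain. Hence V(1 - Q)⁻¹ is the resolvent; V commutes with Q, which makes the
inverse two-sided. The identity R = V + QR is the fixed-point equation used later. -/
theorem isResolventAt_of_norm_lt {μ : ℝ} (hμ : ‖Real.exp (-μ) • T.op 1‖ < 1) :
    ∃ R : E →L[ℝ] E, T.generator.IsResolventAt μ R ∧
      ∀ y, R y = T.truncLaplace μ 1 y + (Real.exp (-μ) • T.op 1) (R y) := by
  set Q : E →L[ℝ] E := Real.exp (-μ) • T.op 1 with hQ
  set V := T.truncLaplace μ 1 with hV
  have hd : ∀ x, T.discounted μ x 1 = Q x := fun x => by simp [discounted, hQ]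
  obtain ⟨N, hVN, hinv, hinv'⟩ : ∃ N : E →L[ℝ] E, V * N = N * V ∧ (∀ y, N y - Q (N y) = y) ∧
      ∀ y, N (y - Q y) = y := by
    let U := Units.oneSub Q hμ
    have hc : Commute V (U : E →L[ℝ] E) := by
      ext x
      simp [U, hQ, hV, T.op_truncLaplace_comm]
    exact ⟨(U⁻¹ : (E →L[ℝ] E)ˣ), hc.units_inv_right.eq,
      fun y => DFunLike.congr_fun U.mul_inv y, fun y => DFunLike.congr_fun U.inv_mul y⟩
  have hVN' : ∀ y, V (N y) = N (V y) := fun y => DFunLike.congr_fun hVN y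
  refine ⟨V.comp N, ⟨fun y => ?_, fun x => ?_⟩, fun y => ?_⟩
  · obtain ⟨h1, h2⟩ := T.truncLaplace_mem_domain μ zero_le_one (N y)
    refine ⟨h1, ?_⟩
    change μ • T.truncLaplace μ 1 (N y) - T.generator ⟨T.truncLaplace μ 1 (N y), h1⟩ = y
    rw [h2, hd, sub_add_cancel_left, neg_sub]
    exact hinv y
  · rw [ContinuousLinearMap.comp_apply, hVN', T.truncLaplace_sub_generator μ zero_le_one, hd]
    exact hinv' x
  · rw [ContinuousLinearMap.comp_apply, hVN', ← sub_eq_iff_eq_add]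
    exact hinv _

end Laplace

end C0Semigroup

/-! ### Tools: affine contractions, density arguments, resolvent identities. -/

/-- An affine strict contraction mapping a closed set into itself has its fixed point there. -/
theorem mem_of_affine_fixedPoint {E : Type*} [NormedAddCommGroup E] [NormedSpace ℝ E]
    {Q : E →L[ℝ] E} (hQ : ‖Q‖ < 1) {s : Set E} (hs : IsClosed s) {a x y : E} (hx : x = a + Q x)
    (hy : y ∈ s) (h : ∀ z ∈ s, a + Q z ∈ s) : x ∈ s := by
  set f : E → E := fun z => a + Q z
  have hmem : ∀ n, f^[n] y ∈ s := fun n => by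
    induction n with
    | zero => exact hy
    | succ k ih => rw [Function.iterate_succ_apply']; exact h _ ih
  have hle : ∀ n, ‖f^[n] y - x‖ ≤ ‖Q‖ ^ n * ‖y - x‖ := fun n => by
    induction n with
    | zero => simp
    | succ k ih =>
      rw [Function.iterate_succ_apply']
      have : f (f^[k] y) - x = Q (f^[k] y - x) := by
        rw [map_sub]
        nth_rewrite 1 [hx]
        simp only [f]
        abel
      rw [this]
      calc _ ≤ ‖Q‖ * ‖f^[k] y - x‖ := Q.le_opNorm _
        _ ≤ ‖Q‖ * (‖Q‖ ^ k * ‖y - x‖) := by gcongr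
        _ = _ := by ring
  refine hs.mem_of_tendsto (f := fun n => f^[n] y) (b := atTop) ?_ (Eventually.of_forall hmem)
  rw [tendsto_iff_norm_sub_tendsto_zero]
  refine squeeze_zero (fun _ => norm_nonneg _) hle ?_
  simpa using (tendsto_pow_atTop_nhds_zero_of_lt_one (norm_nonneg Q) hQ).mul_const ‖y - x‖

theorem tendsto_zero_of_dense_of_norm_le {ι E : Type*} [NormedAddCommGroup E] [NormedSpace ℝ E]
    {l : Filter ι} {H : ι → E →L[ℝ] E} {D : Set E} (hD : Dense D) {C : ℝ}
    (hC : ∀ᶠ i in l, ‖H i‖ ≤ C) (h : ∀ x ∈ D, Tendsto (fun i => H i x) l (𝓝 0)) (u : E) :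
    Tendsto (fun i => H i u) l (𝓝 0) := by
  rw [NormedAddGroup.tendsto_nhds_zero]
  intro ε hε
  have hC' : (0 : ℝ) < |C| + 1 := by positivity
  obtain ⟨x, hx, hxu⟩ := Metric.mem_closure_iff.1 (hD u) (ε / 2 / (|C| + 1)) (by positivity)
  have h1 := NormedAddGroup.tendsto_nhds_zero.1 (h x hx) (ε / 2) (by positivity)
  filter_upwards [hC, h1] with i hi h1i
  have h2 : ‖H i (u - x)‖ ≤ (|C| + 1) * ‖u - x‖ :=
    (H i).le_of_opNorm_le (hi.trans (by linarith [le_abs_self C])) _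
  rw [dist_eq_norm, lt_div_iff₀ hC'] at hxu
  calc ‖H i u‖ = ‖H i (u - x) + H i x‖ := by rw [← map_add, sub_add_cancel]
    _ ≤ ‖H i (u - x)‖ + ‖H i x‖ := norm_add_le _ _
    _ < ε := by linarith

namespace LinearPMap

variable {E : Type*} [NormedAddCommGroup E] [NormedSpace ℝ E] {A : E →ₗ.[ℝ] E}

theorem IsResolventAt.eq_apply_add {μ ν : ℝ} {R S : E →L[ℝ] E} (hR : A.IsResolventAt μ R)
    (hS : A.IsResolventAt ν S) (y : E) : R y = S y + (ν - μ) • S (R y) := by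
  obtain ⟨h, hy⟩ := hR.1 y
  have h2 := hS.2 ⟨R y, h⟩
  have h3 : ν • R y - A ⟨R y, h⟩ = y + (ν - μ) • R y := by
    nth_rewrite 3 [← hy]
    module
  rw [h3, _root_.map_add, _root_.map_smul] at h2
  exact h2.symm

theorem IsResolventAt.smul_sub_self {μ : ℝ} {R : E →L[ℝ] E} (hR : A.IsResolventAt μ R)
    (x : A.domain) : μ • R x - x = R (A x) := by
  have := hR.2 x
  rw [_root_.map_sub, _root_.map_smul] at this
  exact sub_eq_of_eq_add' (sub_eq_iff_eq_add.1 this)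

/-- The resolvent identity gives ‖S‖ ≤ ‖R‖ + ½‖S‖, and the last term is absorbed. -/
theorem norm_resolventOp_le {μ ν : ℝ} (hμ : μ ∈ A.realResolventSet)
    (hν : ν ∈ A.realResolventSet) (h : |ν - μ| * ‖A.resolventOp μ‖ ≤ 1 / 2) :
    ‖A.resolventOp ν‖ ≤ 2 * ‖A.resolventOp μ‖ := by
  set R := A.resolventOp μ
  set S := A.resolventOp ν
  have hS : S = R + (μ - ν) • R.comp S := by
    ext y
    simpa using (A.resolventOp_spec hν).eq_apply_add (A.resolventOp_spec hμ) y
  have h1 : ‖S‖ ≤ ‖R‖ + |ν - μ| * (‖R‖ * ‖S‖) := by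
    calc ‖S‖ = ‖R + (μ - ν) • R.comp S‖ := by rw [← hS]
      _ ≤ ‖R‖ + ‖(μ - ν) • R.comp S‖ := norm_add_le _ _
      _ ≤ _ := by
        rw [norm_smul, Real.norm_eq_abs, abs_sub_comm]
        gcongr
        exact ContinuousLinearMap.opNorm_comp_le _ _
  nlinarith [norm_nonneg S]

end LinearPMap

/-! ### Orbit bounds and their inheritance by resolvents. -/

namespace C0Semigroup

variable {E : Type*} [NormedAddCommGroup E] [NormedSpace ℝ E] (T : C0Semigroup E)

/-- The scalar orbit `t ↦ φ (T(t) b)` is at most `c e^{ω t}`. -/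
def OrbitBound (φ : E →L[ℝ] ℝ) (ω c : ℝ) (b : E) : Prop :=
  ∀ t : ℝ≥0, φ (T.op t b) ≤ c * Real.exp (ω * t)

variable {T} {φ : E →L[ℝ] ℝ} {ω c d : ℝ} {b b' : E}

theorem isClosed_orbitBound : IsClosed {b | T.OrbitBound φ ω c b} := by
  simp only [OrbitBound, Set.ofPred_forall]
  exact isClosed_iInter fun t => isClosed_le (by fun_prop) continuous_const

theorem OrbitBound.op (h : T.OrbitBound φ ω c b) (s : ℝ≥0) :
    T.OrbitBound φ ω (Real.exp (ω * s) * c) (T.op s b) := fun t => by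
  have := h (t + s)
  rw [T.op_add_apply] at this
  refine this.trans_eq ?_
  push_cast
  rw [mul_add, Real.exp_add]
  ring

theorem OrbitBound.add (h : T.OrbitBound φ ω c b) (h' : T.OrbitBound φ ω d b') :
    T.OrbitBound φ ω (c + d) (b + b') := fun t => by
  rw [map_add, map_add, add_mul]
  exact add_le_add (h t) (h' t)

theorem OrbitBound.smul (h : T.OrbitBound φ ω c b) {a : ℝ} (ha : 0 ≤ a) :
    T.OrbitBound φ ω (a * c) (a • b) := fun t => by
  rw [map_smul, map_smul, mul_assoc, smul_eq_mul]
  exact mul_le_mul_of_nonneg_left (h t) ha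

variable (T) in
theorem exists_forall_norm_exp_smul_op_lt :
    ∃ a : ℝ, ∀ μ ≥ a, ‖Real.exp (-μ) • T.op 1‖ < 1 := by
  refine ⟨‖T.op 1‖, fun μ hμ => ?_⟩
  rw [norm_smul, Real.norm_of_nonneg (Real.exp_pos _).le, Real.exp_neg,
    inv_mul_lt_iff₀ (Real.exp_pos _), mul_one]
  linarith [Real.add_one_le_exp μ]

variable (T) in
theorem resolventOp_op_comm {μ : ℝ} (hμ : μ ∈ T.generator.realResolventSet) (t : ℝ≥0) (y : E) :
    T.generator.resolventOp μ (T.op t y) = T.op t (T.generator.resolventOp μ y) := by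
  obtain ⟨h1, h2⟩ := T.generator.resolventOp_spec hμ
  obtain ⟨h3, h4⟩ := h1 y
  obtain ⟨h5, h6⟩ := T.op_mem_domain t ⟨_, h3⟩
  have h7 := h2 ⟨_, h5⟩
  rw [h6] at h7
  simp only at h7
  rwa [← map_smul, ← map_sub, h4] at h7

variable (T) in
/-- The orbit bound for the resolvent propagates down the resolvent set by a contraction
argument. -/
theorem orbitBound_resolventOp_of_lt {μ ν : ℝ} (hμ : ω < μ) (hμν : μ < ν)
    (hμR : μ ∈ T.generator.realResolventSet) (hνR : ν ∈ T.generator.realResolventSet)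
    (hsmall : (ν - μ) * ‖T.generator.resolventOp ν‖ < 1)
    (hν : ∀ b c, T.OrbitBound φ ω c b →
      T.OrbitBound φ ω (c / (ν - ω)) (T.generator.resolventOp ν b))
    (h : T.OrbitBound φ ω c b) :
    T.OrbitBound φ ω (c / (μ - ω)) (T.generator.resolventOp μ b) := by
  have hμ' : 0 < μ - ω := by linarith
  have hν' : 0 < ν - ω := by linarith
  have hQ : ‖(ν - μ) • T.generator.resolventOp ν‖ < 1 := by
    rwa [norm_smul, Real.norm_of_nonneg (by linarith)]
  refine mem_of_affine_fixedPoint hQ (isClosed_orbitBound (T := T) (φ := φ) (ω := ω)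
    (c := c / (μ - ω))) ((T.generator.resolventOp_spec hμR).eq_apply_add
      (T.generator.resolventOp_spec hνR) b) (y := (μ - ω)⁻¹ • b) ?_ fun z hz => ?_
  · have := h.smul (inv_nonneg.2 hμ'.le)
    rwa [inv_mul_eq_div] at this
  · have h1 := (hν b c h).add ((hν z _ hz).smul (sub_nonneg.2 hμν.le))
    -- The constant c/(μ - ω) is exactly the one reproduced by the affine map z ↦ R_ν b + (ν - μ)
    -- R_ν z, so the set of vectors with this bound is invariant.
    have h2 : c / (ν - ω) + (ν - μ) * (c / (μ - ω) / (ν - ω)) = c / (μ - ω) := by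
      field_simp
      ring
    rw [h2] at h1
    exact h1

variable [CompleteSpace E]

/-- Integrate the pointwise bound: ∫₀¹ e^{(ω-μ)s} ds = (1 - e^{ω-μ})/(μ - ω). Keeping this exact
value lets the constants in the fixed-point argument close up without loss. -/
theorem OrbitBound.truncLaplace (h : T.OrbitBound φ ω c b) {μ : ℝ} (hμ : ω < μ) :
    T.OrbitBound φ ω ((1 - Real.exp (ω - μ)) * (c / (μ - ω))) (T.truncLaplace μ 1 b) := by
  have hne : ω - μ ≠ 0 := by linarith
  intro t
  have hcont : Continuous fun s => T.op t (T.discounted μ b s) :=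
    (T.op t).continuous.comp (T.continuous_discounted μ b)
  rw [op_truncLaplace_eq_integral, ← φ.intervalIntegral_comp_comm (hcont.intervalIntegrable _ _)]
  have hle : ∀ s ∈ Set.Icc (0 : ℝ) 1, φ (T.op t (T.discounted μ b s))
      ≤ c * Real.exp (ω * t) * Real.exp ((ω - μ) * s) := fun s hs => by
    rw [discounted, map_smul, map_smul, ← T.op_add_apply, smul_eq_mul]
    have h1 := h (t + s.toNNReal)
    push_cast at h1
    rw [Real.coe_toNNReal s hs.1] at h1
    calc _ ≤ Real.exp (-μ * s) * (c * Real.exp (ω * (t + s))) := by gcongr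
      _ = _ := by
        rw [mul_add, Real.exp_add, sub_mul, sub_eq_add_neg, Real.exp_add, neg_mul]
        ring
  have hint : ∫ s in (0 : ℝ)..1, c * Real.exp (ω * t) * Real.exp ((ω - μ) * s)
      = (1 - Real.exp (ω - μ)) * (c / (μ - ω)) * Real.exp (ω * t) := by
    rw [intervalIntegral.integral_const_mul, intervalIntegral.integral_comp_mul_left _ hne,
      integral_exp]
    have : μ - ω ≠ 0 := by linarith
    have h3 : (ω - μ)⁻¹ = - (μ - ω)⁻¹ := by rw [← inv_neg, neg_sub]
    simp only [mul_zero, mul_one, Real.exp_zero, smul_eq_mul, h3]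
    field_simp
    ring
  rw [← hint]
  refine intervalIntegral.integral_mono_on zero_le_one ?_ ?_ hle
  · exact (φ.continuous.comp hcont).intervalIntegrable _ _
  · exact (by fun_prop : Continuous fun s : ℝ =>
      c * Real.exp (ω * t) * Real.exp ((ω - μ) * s)).intervalIntegrable _ _

/-- The vector Rb is the fixed point of z ↦ Vb + Qz. This map preserves the closed set of vectors
with constant k = c/(μ - ω), because (1 - e^{ω-μ})k + e^{-μ}e^{ω}k = k. -/
theorem OrbitBound.resolventOp_of_norm_lt (h : T.OrbitBound φ ω c b) {μ : ℝ} (hμ : ω < μ)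
    (hQ : ‖Real.exp (-μ) • T.op 1‖ < 1) :
    T.OrbitBound φ ω (c / (μ - ω)) (T.generator.resolventOp μ b) := by
  have hμ' : 0 < μ - ω := by linarith
  obtain ⟨R, hR, hfix⟩ := T.isResolventAt_of_norm_lt hQ
  have hRe : T.generator.resolventOp μ = R :=
    (T.generator.resolventOp_spec ⟨R, hR⟩).unique hR
  rw [hRe]
  refine mem_of_affine_fixedPoint hQ (isClosed_orbitBound (T := T) (φ := φ) (ω := ω)
    (c := c / (μ - ω))) (hfix b) (y := (μ - ω)⁻¹ • b) ?_ fun z hz => ?_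
  · have := h.smul (inv_nonneg.2 hμ'.le)
    rwa [inv_mul_eq_div] at this
  · have h1 := (h.truncLaplace hμ).add ((OrbitBound.op hz 1).smul (Real.exp_pos (-μ)).le)
    have h2 : (1 - Real.exp (ω - μ)) * (c / (μ - ω))
        + Real.exp (-μ) * (Real.exp (ω * (1 : ℝ≥0)) * (c / (μ - ω))) = c / (μ - ω) := by
      rw [← mul_assoc (Real.exp (-μ)), ← Real.exp_add, NNReal.coe_one, mul_one,
        neg_add_eq_sub]
      ring
    rw [h2] at h1
    exact h1

/-- Large parameters are good. If some were bad, take their supremum s: the resolvent is bounded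
near s, so a step of fixed length from just above s reaches a bad parameter just below or at s, a
contradiction. -/
theorem OrbitBound.resolventOp (h : T.OrbitBound φ ω c b) {μ : ℝ} (hμ : ω < μ)
    (hR : Set.Ici μ ⊆ T.generator.realResolventSet) :
    T.OrbitBound φ ω (c / (μ - ω)) (T.generator.resolventOp μ b) := by
  obtain ⟨a, ha⟩ := T.exists_forall_norm_exp_smul_op_lt
  let Good : ℝ → Prop := fun ν => ∀ b c, T.OrbitBound φ ω c b →
      T.OrbitBound φ ω (c / (ν - ω)) (T.generator.resolventOp ν b)
  suffices hg : Good μ from hg b c h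
  by_contra hbad
  let S : Set ℝ := {ν | μ ≤ ν ∧ ¬ Good ν}
  have hSne : S.Nonempty := ⟨μ, le_rfl, hbad⟩
  have hSbd : BddAbove S := by
    refine ⟨a, fun ν hν => ?_⟩
    by_contra! hlt
    exact hν.2 fun b c hb => hb.resolventOp_of_norm_lt (hμ.trans_le hν.1) (ha ν hlt.le)
  set s := sSup S with hs
  have hμs : μ ≤ s := le_csSup hSbd ⟨le_rfl, hbad⟩
  set r := ‖T.generator.resolventOp s‖ with hr
  have hr0 : 0 ≤ r := norm_nonneg _
  -- Since εr ≤ 1/4, the step from ν = s + ε/2 to a bad ν' > s - ε has length at most 3ε/2; with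
  -- ‖R_ν‖ ≤ 2r the contraction factor is at most 3/4.
  set ε := 1 / (4 * (r + 1)) with hε
  have hε0 : 0 < ε := by positivity
  have hεr : ε * r ≤ 1 / 4 := by
    rw [hε, div_mul_eq_mul_div, div_le_div_iff₀ (by positivity) (by norm_num)]
    linarith
  obtain ⟨ν', hν'S, hν'⟩ := exists_lt_of_lt_csSup hSne (show s - ε < sSup S by linarith)
  have hν's : ν' ≤ s := le_csSup hSbd hν'S
  set ν := s + ε / 2 with hν
  have hνR : ν ∈ T.generator.realResolventSet := hR (by simp only [Set.mem_Ici]; linarith)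
  have hνgood : Good ν := by
    by_contra hn
    have := le_csSup hSbd (show ν ∈ S from ⟨by linarith, hn⟩)
    linarith
  have hνn : ‖T.generator.resolventOp ν‖ ≤ 2 * r := by
    refine LinearPMap.norm_resolventOp_le (hR hμs) hνR ?_
    rw [← hr, hν, add_sub_cancel_left, abs_of_pos (by linarith)]
    linarith
  refine hν'S.2 fun b c hb => T.orbitBound_resolventOp_of_lt (hμ.trans_le hν'S.1)
    (by linarith : ν' < ν) (hR hν'S.1) hνR ?_ hνgood hb
  calc (ν - ν') * ‖T.generator.resolventOp ν‖ ≤ (3 / 2 * ε) * (2 * r) := by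
        gcongr; linarith
    _ < 1 := by linarith

theorem OrbitBound.resolventOp_pow (h : T.OrbitBound φ ω c b) {μ : ℝ} (hμ : ω < μ)
    (hR : Set.Ici μ ⊆ T.generator.realResolventSet) (n : ℕ) :
    T.OrbitBound φ ω (c / (μ - ω) ^ n) ((T.generator.resolventOp μ ^ n) b) := by
  induction n with
  | zero => simpa using h
  | succ k ih =>
    have := ih.resolventOp hμ hR
    rw [div_div, ← pow_succ] at this
    rw [pow_succ' (T.generator.resolventOp μ)]
    exact this

theorem OrbitBound.apply_resolventOp_pow_le (h : T.OrbitBound φ ω c b) {μ : ℝ} (hμ : ω < μ)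
    (hR : Set.Ici μ ⊆ T.generator.realResolventSet) (n : ℕ) :
    φ ((T.generator.resolventOp μ ^ n) b) ≤ c / (μ - ω) ^ n := by
  simpa [T.op_zero_apply] using h.resolventOp_pow hμ hR n 0

variable (T)

theorem exists_Ici_subset_realResolventSet :
    ∃ a : ℝ, Set.Ici a ⊆ T.generator.realResolventSet := by
  obtain ⟨a, ha⟩ := T.exists_forall_norm_exp_smul_op_lt
  refine ⟨a, fun μ hμ => ?_⟩
  obtain ⟨R, hR, -⟩ := T.isResolventAt_of_norm_lt (ha μ hμ)
  exact ⟨R, hR⟩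

/-- A norming functional of Rⁿy turns the growth bound into a scalar orbit bound for y. Iterating
that bound, and not ‖R‖, keeps the single factor K. -/
theorem norm_resolventOp_pow_le {K β μ : ℝ} (hK : 0 ≤ K)
    (hb : ∀ t : ℝ≥0, ‖T.op t‖ ≤ K * Real.exp (β * t)) (hμ : β < μ)
    (hR : Set.Ici μ ⊆ T.generator.realResolventSet) (n : ℕ) :
    ‖T.generator.resolventOp μ ^ n‖ ≤ K / (μ - β) ^ n := by
  have hμ' : 0 < μ - β := by linarith
  refine ContinuousLinearMap.opNorm_le_bound _ (by positivity) fun y => ?_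
  obtain ⟨φ, hφ, hφy⟩ := exists_dual_vector'' ℝ ((T.generator.resolventOp μ ^ n) y)
  have h1 : T.OrbitBound φ β (K * ‖y‖) y := fun t => by
    calc φ (T.op t y) ≤ ‖φ (T.op t y)‖ := Real.le_norm_self _
      _ ≤ 1 * ‖T.op t y‖ := φ.le_of_opNorm_le hφ _
      _ ≤ 1 * (K * Real.exp (β * t) * ‖y‖) := by
        gcongr
        exact (T.op t).le_of_opNorm_le (hb t) y
      _ = _ := by ring
  have h2 := h1.apply_resolventOp_pow_le hμ hR n
  rw [hφy] at h2
  calc _ ≤ _ := h2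
    _ = _ := by ring

/-- On the domain μRx - x = RAx = O(1/(μ - β)); the operators μR stay bounded, so density finishes.
-/
theorem tendsto_smul_resolventOp (u : E) :
    Tendsto (fun μ : ℝ => μ • T.generator.resolventOp μ u) atTop (𝓝 u) := by
  obtain ⟨K, β, hK, hβ, hb⟩ := T.exists_growth_bound
  obtain ⟨a, ha⟩ := T.exists_Ici_subset_realResolventSet
  have hn : ∀ᶠ μ : ℝ in atTop, ‖T.generator.resolventOp μ‖ ≤ K / (μ - β) := by
    filter_upwards [eventually_gt_atTop β, eventually_ge_atTop a] with μ h1 h2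
    simpa using T.norm_resolventOp_pow_le (by linarith) hb h1
      ((Set.Ici_subset_Ici.2 h2).trans ha) 1
  have key : Tendsto (fun μ : ℝ =>
      (μ • T.generator.resolventOp μ - ContinuousLinearMap.id ℝ E) u) atTop (𝓝 0) := by
    refine tendsto_zero_of_dense_of_norm_le T.dense_domain (C := 2 * K + 1) ?_ ?_ u
    · filter_upwards [hn, eventually_gt_atTop (2 * β), eventually_gt_atTop 0] with μ h1 h2 h3
      have h4 : 0 < μ - β := by linarith
      calc _ ≤ ‖μ • T.generator.resolventOp μ‖ + ‖ContinuousLinearMap.id ℝ E‖ := norm_sub_le _ _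
        _ ≤ 2 * K + 1 := by
          gcongr
          · rw [norm_smul, Real.norm_of_nonneg h3.le]
            calc _ ≤ μ * (K / (μ - β)) := by gcongr
              _ ≤ 2 * K := by
                rw [← mul_div_assoc, div_le_iff₀ h4]
                nlinarith
          · exact ContinuousLinearMap.norm_id_le
    · intro x hx
      have h0 : Tendsto (fun μ : ℝ => K / (μ - β) * ‖T.generator ⟨x, hx⟩‖) atTop (𝓝 0) := by
        have : Tendsto (fun μ : ℝ => K / (μ - β)) atTop (𝓝 0) :=
          tendsto_const_nhds.div_atTop (tendsto_atTop_add_const_right _ _ tendsto_id)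
        simpa using this.mul_const _
      refine squeeze_zero_norm' ?_ h0
      filter_upwards [hn, eventually_ge_atTop a] with μ h1 h2
      have := (T.generator.resolventOp_spec (ha h2)).smul_sub_self ⟨x, hx⟩
      simp only [sub_apply, smul_apply,
        ContinuousLinearMap.id_apply]
      rw [this]
      exact (T.generator.resolventOp μ).le_of_opNorm_le h1 _
  simpa using key.add_const u

end C0Semigroup

/-! ### The exponential formula. -/

namespace C0Semigroup

variable {E : Type*} [NormedAddCommGroup E] [NormedSpace ℝ E] [CompleteSpace E]
  (T : C0Semigroup E)

/-- With x = βt/n < 1/2 the base is (1 - x)⁻¹ ≤ e^{2x}. This gives stability: powers up to n of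
(n/t)(n/t - A)⁻¹ are bounded uniformly in n. -/
theorem div_sub_pow_le_exp {β t : ℝ} (hβ : 0 ≤ β) (ht : 0 < t) {n i : ℕ} (hin : i ≤ n)
    (hn : 2 * (β * t) < n) : (n / t) ^ i / (n / t - β) ^ i ≤ Real.exp (2 * (β * t)) := by
  have hn0 : (0 : ℝ) < n := by
    have : 0 ≤ β * t := by positivity
    linarith
  set x := β * t / n with hx
  have hx0 : 0 ≤ x := by positivity
  have hx1 : x < 1 / 2 := by
    rw [hx, div_lt_iff₀ hn0]; linarith
  have h1 : n / t / (n / t - β) = (1 - x)⁻¹ := by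
    have : n / t - β = n / t * (1 - x) := by rw [hx]; field_simp
    rw [this]
    have : (1 - x) ≠ 0 := by linarith
    field_simp
  have h2 : (1 - x)⁻¹ ≤ Real.exp (2 * x) := by
    rw [inv_le_iff_one_le_mul₀ (by linarith)]
    nlinarith [Real.add_one_le_exp (2 * x)]
  rw [← div_pow, h1]
  calc (1 - x)⁻¹ ^ i ≤ Real.exp (2 * x) ^ i := by
        gcongr
        exact inv_nonneg.2 (by linarith)
    _ ≤ Real.exp (2 * x) ^ n := pow_le_pow_right₀ (Real.one_le_exp (by positivity)) hin
    _ = Real.exp (2 * (β * t)) := by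
      rw [← Real.exp_nat_mul]
      congr 1
      rw [hx]
      field_simp

/-- The exponential formula `T(t) u = lim (n/t)ⁿ (n/t - A)⁻ⁿ u`. -/
theorem tendsto_resolventOp_pow {t : ℝ≥0} (ht : 0 < t) (u : E) :
    Tendsto (fun n : ℕ => ((n / t : ℝ) ^ n) • (T.generator.resolventOp (n / t) ^ n) u) atTop
      (𝓝 (T.op t u)) := by
  obtain ⟨K, β, hK, hβ, hb⟩ := T.exists_growth_bound
  obtain ⟨a, ha⟩ := T.exists_Ici_subset_realResolventSet
  have ht' : (0 : ℝ) < t := by exact_mod_cast ht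
  have hμ : Tendsto (fun n : ℕ => (n / t : ℝ)) atTop atTop :=
    tendsto_natCast_atTop_atTop.atTop_div_const ht'
  set F : ℕ → E →L[ℝ] E := fun n => (n / t : ℝ) • T.generator.resolventOp (n / t) with hF
  set G : ℕ → E →L[ℝ] E := fun n => T.op (t / n) with hG
  set B := Real.exp (2 * (β * t)) with hB
  have hB0 : 0 < B := Real.exp_pos _
  have hB1 : Real.exp (β * t) ≤ B := Real.exp_le_exp.2 (by nlinarith [mul_nonneg hβ ht'.le])
  have hgood : ∀ᶠ n : ℕ in atTop, 0 < (n : ℝ) ∧ a ≤ n / t ∧ β < n / t ∧ 2 * (β * t) < n := by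
    filter_upwards [eventually_gt_atTop 0, hμ.eventually_ge_atTop a, hμ.eventually_gt_atTop β,
      tendsto_natCast_atTop_atTop.eventually_gt_atTop (2 * (β * (t : ℝ)))] with n h1 h2 h3 h4
    exact ⟨by exact_mod_cast h1, h2, h3, h4⟩
  have hFpow : ∀ᶠ n : ℕ in atTop, ∀ i ≤ n, ‖F n ^ i‖ ≤ K * B := by
    filter_upwards [hgood] with n ⟨h1, h2, h3, h4⟩ i hi
    have h5 := T.norm_resolventOp_pow_le (by linarith) hb h3 ((Set.Ici_subset_Ici.2 h2).trans ha) i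
    rw [hF, smul_pow, norm_smul, Real.norm_of_nonneg (by positivity)]
    calc _ ≤ (n / t : ℝ) ^ i * (K / (n / t - β) ^ i) := by gcongr
      _ = K * ((n / t : ℝ) ^ i / (n / t - β) ^ i) := by ring
      _ ≤ K * B := by
        gcongr
        exact div_sub_pow_le_exp hβ ht' hi h4
  have hGpow : ∀ n : ℕ, 0 < (n : ℝ) → ∀ i ≤ n, ‖G n ^ i‖ ≤ K * B := by
    intro n hn i hi
    rw [hG, T.op_pow]
    refine (hb _).trans ?_
    have : ((i * (t / n) : ℝ≥0) : ℝ) ≤ t := by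
      push_cast
      rw [← mul_div_assoc, div_le_iff₀ hn, mul_comm]
      gcongr
    calc K * Real.exp (β * (i * (t / n) : ℝ≥0)) ≤ K * Real.exp (β * t) := by gcongr
      _ ≤ _ := by gcongr
  have hGn : ∀ n : ℕ, 0 < (n : ℝ) → G n ^ n = T.op t := by
    intro n hn
    have : (n : ℝ≥0) ≠ 0 := by
      have : (0 : ℝ≥0) < n := by exact_mod_cast hn
      exact this.ne'
    rw [hG, T.op_pow, mul_div_cancel₀ _ this]
  have key : Tendsto (fun n => (F n ^ n - T.op t) u) atTop (𝓝 0) := by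
    refine tendsto_zero_of_dense_of_norm_le T.dense_domain (C := K * B + ‖T.op t‖) ?_ ?_ u
    · filter_upwards [hFpow] with n hn
      exact (norm_sub_le _ _).trans (by gcongr; exact hn n le_rfl)
    · intro x hx
      -- Consistency: both n(Fₙx - x) and n(Gₙx - x) tend to tAx.
      have hdiff : Tendsto (fun n : ℕ => (n : ℝ) * ‖(F n - G n) x‖) atTop (𝓝 0) := by
        have hinv : Tendsto (fun n : ℕ => t / (n : ℝ≥0)) atTop (𝓝[>] 0) := by
          refine tendsto_nhdsWithin_iff.2 ⟨?_, ?_⟩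
          · exact tendsto_const_div_atTop_nhds_zero_nat t
          · filter_upwards [eventually_gt_atTop 0] with n hn
            have : (0 : ℝ≥0) < n := by exact_mod_cast hn
            exact div_pos ht this
        have h1 := (T.tendsto_generator ⟨x, hx⟩).comp hinv
        have h2 := (T.tendsto_smul_resolventOp (T.generator ⟨x, hx⟩)).comp hμ
        have h3 := ((h2.sub h1).norm).const_mul (t : ℝ)
        rw [sub_self, norm_zero, mul_zero] at h3
        refine h3.congr' ?_
        filter_upwards [hgood] with n ⟨hn, h2, _, _⟩
        have h4 := (T.generator.resolventOp_spec (ha h2)).smul_sub_self ⟨x, hx⟩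
        have h5 : (F n - G n) x = (F n x - x) - (G n x - x) := by
          rw [sub_apply]; abel
        have h6 : F n x - x = T.generator.resolventOp (n / t) (T.generator ⟨x, hx⟩) := h4
        have h7 : (((t / n : ℝ≥0) : ℝ))⁻¹ = n / t := by push_cast; rw [inv_div]
        simp only [Function.comp_apply]
        rw [h5, h6, h7, ← smul_sub, norm_smul, Real.norm_of_nonneg (by positivity), ← mul_assoc,
          mul_div_cancel₀ _ ht'.ne']
      have h0 := hdiff.const_mul (K * B * (K * B))
      rw [mul_zero] at h0
      refine squeeze_zero_norm' ?_ h0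
      filter_upwards [hgood, hFpow] with n ⟨hn, h2, _, _⟩ hFn
      have hc : Commute (F n) (G n) := by
        ext y
        simp [hF, hG, T.resolventOp_op_comm (ha h2)]
      -- Fₙ and Gₙ commute, so Fₙⁿ - Gₙⁿ is this sum times Fₙ - Gₙ; its growth of order n is beaten
      -- by `hdiff`.
      have hS : ‖∑ i ∈ Finset.range n, F n ^ i * G n ^ (n - 1 - i)‖ ≤ n * (K * B * (K * B)) := by
        refine (norm_sum_le_of_le (f := fun i => F n ^ i * G n ^ (n - 1 - i)) _
          (n := fun _ => K * B * (K * B)) fun i hi => ?_).trans (by simp)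
        rw [Finset.mem_range] at hi
        refine (norm_mul_le _ _).trans ?_
        gcongr
        · exact hFn i hi.le
        · exact hGpow n hn _ (by omega)
      rw [← hGn n hn, ← hc.geom_sum₂_mul n]
      calc _ ≤ n * (K * B * (K * B)) * ‖(F n - G n) x‖ :=
            ContinuousLinearMap.le_of_opNorm_le _ hS _
        _ = _ := by ring
  have := key.add_const (T.op t u)
  simp only [sub_apply, sub_add_cancel, zero_add] at this
  refine this.congr fun n => ?_
  rw [hF, smul_pow]
  rfl

end C0Semigroup

/-! ### Order and integrability in L₂ tested on sets of finite measure. -/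

section L2Pairing

variable {Ω : Type*} [MeasurableSpace Ω] {m : Measure Ω}

theorem L2.real_inner_eq_integral_mul (f g : Lp ℝ 2 m) : ⟪f, g⟫_ℝ = ∫ x, f x * g x ∂m := by
  rw [L2.inner_def]
  simp [mul_comm]

theorem L2.integrable_mul (f g : Lp ℝ 2 m) : Integrable (fun x => f x * g x) m := by
  have := L2.integrable_inner (𝕜 := ℝ) f g
  simpa [mul_comm] using this

theorem L2.inner_indicator_one {s : Set Ω} (hs : MeasurableSet s) (hm : m s ≠ ⊤)
    (f : Lp ℝ 2 m) : ⟪f, indicatorConstLp 2 hs hm (1 : ℝ)⟫_ℝ = ∫ x in s, f x ∂m := by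
  rw [real_inner_comm, L2.inner_indicatorConstLp_one]

theorem l1Norm_nonneg (f : Lp ℝ 2 m) : 0 ≤ l1Norm f :=
  integral_nonneg fun _ => abs_nonneg _

theorem indicatorConstLp_one_nonneg {s : Set Ω} (hs : MeasurableSet s) (hm : m s ≠ ⊤) :
    0 ≤ indicatorConstLp 2 hs hm (1 : ℝ) := by
  rw [← Lp.coeFn_nonneg]
  filter_upwards [indicatorConstLp_coeFn (p := 2) (hs := hs) (hμs := hm) (c := (1 : ℝ))] with x hx
  rw [hx]
  exact Set.indicator_nonneg (fun _ _ => zero_le_one) x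

theorem integrable_indicatorConstLp_one {s : Set Ω} (hs : MeasurableSet s) (hm : m s ≠ ⊤) :
    Integrable (indicatorConstLp 2 hs hm (1 : ℝ)) m := by
  refine Integrable.congr ?_ (indicatorConstLp_coeFn (p := 2) (hs := hs) (hμs := hm)
    (c := (1 : ℝ))).symm
  exact (integrable_indicator_iff hs).2 (integrableOn_const hm)

theorem l1Norm_indicatorConstLp_one {s : Set Ω} (hs : MeasurableSet s) (hm : m s ≠ ⊤) :
    l1Norm (indicatorConstLp 2 hs hm (1 : ℝ)) = m.real s := by
  have : ∀ᵐ x ∂m, |indicatorConstLp 2 hs hm (1 : ℝ) x| = s.indicator (fun _ => (1 : ℝ)) x := by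
    filter_upwards [indicatorConstLp_coeFn (p := 2) (hs := hs) (hμs := hm) (c := (1 : ℝ))]
      with x hx
    rw [hx]
    exact abs_of_nonneg (Set.indicator_nonneg (fun _ _ => zero_le_one) x)
  rw [l1Norm, integral_congr_ae this, integral_indicator_const _ hs]
  simp

theorem L2.inner_nonneg_of_nonneg {f g : Lp ℝ 2 m} (hf : 0 ≤ f) (hg : 0 ≤ g) : 0 ≤ ⟪f, g⟫_ℝ := by
  rw [L2.real_inner_eq_integral_mul]
  refine integral_nonneg_of_ae ?_
  filter_upwards [(Lp.coeFn_nonneg f).2 hf, (Lp.coeFn_nonneg g).2 hg] with x h1 h2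
  exact mul_nonneg h1 h2

theorem L2.inner_indicator_one_le_l1Norm {s : Set Ω} (hs : MeasurableSet s) (hm : m s ≠ ⊤)
    {f : Lp ℝ 2 m} (hf : Integrable f m) :
    ⟪f, indicatorConstLp 2 hs hm (1 : ℝ)⟫_ℝ ≤ l1Norm f := by
  rw [L2.inner_indicator_one]
  calc ∫ x in s, f x ∂m ≤ ∫ x in s, |f x| ∂m :=
        integral_mono hf.integrableOn hf.abs.integrableOn fun x => le_abs_self _
    _ ≤ _ := setIntegral_le_integral hf.abs (Eventually.of_forall fun x => abs_nonneg _)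

/-- Pairing `f ≤ g + K 𝟙` with a nonnegative element of `L₂ ∩ L₁`. -/
theorem L2.inner_le_of_ae_le {f g v : Lp ℝ 2 m} {K : ℝ} (hv : 0 ≤ v) (hvi : Integrable v m)
    (h : ∀ᵐ x ∂m, f x ≤ g x + K) : ⟪f, v⟫_ℝ ≤ ⟪g, v⟫_ℝ + K * l1Norm v := by
  rw [L2.real_inner_eq_integral_mul, L2.real_inner_eq_integral_mul, l1Norm,
    ← integral_const_mul, ← integral_add (L2.integrable_mul g v) (hvi.abs.const_mul K)]
  refine integral_mono_ae (L2.integrable_mul f v)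
    ((L2.integrable_mul g v).add (hvi.abs.const_mul K)) ?_
  filter_upwards [h, (Lp.coeFn_nonneg v).2 hv] with x h1 h2
  simp only [Pi.zero_apply] at h2
  simp only [abs_of_nonneg h2]
  rw [← add_mul]
  exact mul_le_mul_of_nonneg_right h1 h2

theorem L2.measure_le_coeFn_ne_top (f : Lp ℝ 2 m) {ε : ℝ} (hε : 0 < ε) :
    m {x | ε ≤ f x} ≠ ⊤ := by
  have := (Lp.memLp f).meas_ge_lt_top (by norm_num) (by norm_num)
    (ε := ε.toNNReal) (by simpa using hε)
  refine (lt_of_le_of_lt (measure_mono fun x hx => ?_) this).ne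
  have hx' : ε ≤ f x := hx
  change ε.toNNReal ≤ ‖f x‖₊
  rw [Real.toNNReal_le_iff_le_coe, coe_nnnorm]
  exact hx'.trans (Real.le_norm_self _)

/-- Test on the set where f - g ≥ K + δ. Since K + δ > 0 and f - g is in L₂, it has finite measure,
and the two integral estimates force that measure to vanish. Here K ≥ 0 is essential to the choice
of test set. -/
theorem L2.ae_le_add_of_forall_inner_le {f g : Lp ℝ 2 m} {K : ℝ} (hK : 0 ≤ K)
    (h : ∀ (s : Set Ω) (hs : MeasurableSet s) (hm : m s ≠ ⊤),
      ⟪f, indicatorConstLp 2 hs hm (1 : ℝ)⟫_ℝ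
        ≤ ⟪g, indicatorConstLp 2 hs hm (1 : ℝ)⟫_ℝ + K * m.real s) :
    ∀ᵐ x ∂m, f x ≤ g x + K := by
  have key : ∀ n : ℕ, m {x | K + 1 / ((n : ℝ) + 1) ≤ (f - g : Lp ℝ 2 m) x} = 0 := by
    intro n
    set δ : ℝ := 1 / ((n : ℝ) + 1) with hδ
    have hδ0 : 0 < δ := by positivity
    set s : Set Ω := {x | K + δ ≤ (f - g : Lp ℝ 2 m) x} with hsdef
    have hs : MeasurableSet s :=
      measurableSet_le measurable_const (Lp.stronglyMeasurable (f - g)).measurable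
    have hm : m s ≠ ⊤ := L2.measure_le_coeFn_ne_top (f - g) (by positivity)
    have h1 := h s hs hm
    have h2 : ∫ x in s, (f - g : Lp ℝ 2 m) x ∂m ≤ K * m.real s := by
      rw [← L2.inner_indicator_one hs hm, inner_sub_left]
      linarith
    have h3 : (K + δ) * m.real s ≤ ∫ x in s, (f - g : Lp ℝ 2 m) x ∂m := by
      calc (K + δ) * m.real s = ∫ x in s, (K + δ) ∂m := by simp [mul_comm]
        _ ≤ _ := setIntegral_mono_on (integrableOn_const hm)
          (integrableOn_Lp_of_measure_ne_top _ (by norm_num) hm) hs fun x hx => hx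
    have h4 : m.real s = 0 := by
      have := measureReal_nonneg (μ := m) (s := s)
      nlinarith
    rwa [measureReal_eq_zero_iff hm] at h4
  have key' : ∀ᵐ x ∂m, ∀ n : ℕ, ¬ (K + 1 / ((n : ℝ) + 1) ≤ (f - g : Lp ℝ 2 m) x) :=
    ae_all_iff.2 fun n => by
      rw [ae_iff]
      simpa using key n
  filter_upwards [key', Lp.coeFn_sub f g] with x hx hfg
  simp only [hfg, Pi.sub_apply, not_le] at hx
  by_contra! hlt
  obtain ⟨n, hn⟩ := exists_nat_one_div_lt (show 0 < f x - g x - K by linarith)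
  linarith [hx n]

theorem L2.nonneg_of_forall_inner_nonneg {f : Lp ℝ 2 m}
    (h : ∀ (s : Set Ω) (hs : MeasurableSet s) (hm : m s ≠ ⊤),
      0 ≤ ⟪f, indicatorConstLp 2 hs hm (1 : ℝ)⟫_ℝ) : 0 ≤ f := by
  rw [← Lp.coeFn_le]
  have := L2.ae_le_add_of_forall_inner_le (f := 0) (g := f) le_rfl fun s hs hm => by
    simpa using h s hs hm
  filter_upwards [this, Lp.coeFn_zero ℝ 2 m] with x h1 h2
  simpa [h2] using h1

/-- A nonnegative element of `L₂` whose integrals over sets of finite measure are bounded by `c`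
lies in `L₁`, with norm at most `c`. -/
theorem L2.integrable_of_forall_inner_le {f : Lp ℝ 2 m} (hf : 0 ≤ f) {c : ℝ}
    (h : ∀ (s : Set Ω) (hs : MeasurableSet s) (hm : m s ≠ ⊤),
      ⟪f, indicatorConstLp 2 hs hm (1 : ℝ)⟫_ℝ ≤ c) : Integrable f m ∧ l1Norm f ≤ c := by
  have hc : 0 ≤ c := by
    simpa using h ∅ MeasurableSet.empty (by simp)
  have hf0 : 0 ≤ᵐ[m] f := (Lp.coeFn_nonneg f).2 hf
  have hmeas : Measurable f := (Lp.stronglyMeasurable f).measurable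
  have hmono : Monotone fun n : ℕ => {x | 1 / ((n : ℝ) + 1) ≤ f x} := by
    intro i j hij x hx
    have hx' : 1 / ((i : ℝ) + 1) ≤ f x := hx
    exact (Nat.one_div_le_one_div hij).trans hx'
  have hsupp : Function.support (fun x => ENNReal.ofReal (f x))
      = ⋃ n : ℕ, {x | 1 / ((n : ℝ) + 1) ≤ f x} := by
    ext x
    simp only [Function.mem_support, ne_eq, ENNReal.ofReal_eq_zero, not_le, Set.mem_iUnion]
    constructor
    · intro hx
      obtain ⟨n, hn⟩ := exists_nat_one_div_lt hx
      exact ⟨n, hn.le⟩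
    · rintro ⟨n, hn⟩
      exact lt_of_lt_of_le (by positivity) (show 1 / ((n : ℝ) + 1) ≤ f x from hn)
  -- The support of f is an increasing union of superlevel sets of finite measure, so monotone
  -- convergence carries the bound over.
  have hlint : ∫⁻ x, ENNReal.ofReal (f x) ∂m ≤ ENNReal.ofReal c := by
    rw [← Set.indicator_support (f := fun x => ENNReal.ofReal (f x)), lintegral_indicator
      (measurableSet_support hmeas.ennreal_ofReal), hsupp,
      setLIntegral_iUnion_of_directed _ hmono.directed_le]
    refine iSup_le fun n => ?_
    have hs : MeasurableSet {x | 1 / ((n : ℝ) + 1) ≤ f x} :=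
      measurableSet_le measurable_const hmeas
    have hm : m {x | 1 / ((n : ℝ) + 1) ≤ f x} ≠ ⊤ :=
      L2.measure_le_coeFn_ne_top f (by positivity)
    rw [← ofReal_integral_eq_lintegral_ofReal
      (integrableOn_Lp_of_measure_ne_top _ (by norm_num) hm) (ae_restrict_of_ae hf0),
      ← L2.inner_indicator_one hs hm]
    exact ENNReal.ofReal_le_ofReal (h _ hs hm)
  have hint : Integrable f m :=
    (lintegral_ofReal_ne_top_iff_integrable hmeas.aestronglyMeasurable hf0).1
      (ne_top_of_le_ne_top ENNReal.ofReal_ne_top hlint)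
  refine ⟨hint, ?_⟩
  have habs : ∫ x, |f x| ∂m = ∫ x, f x ∂m := by
    refine integral_congr_ae ?_
    filter_upwards [hf0] with x hx
    exact abs_of_nonneg hx
  rw [l1Norm, habs, integral_eq_lintegral_of_nonneg_ae hf0 hmeas.aestronglyMeasurable]
  exact ENNReal.toReal_le_of_le_ofReal hc hlint

end L2Pairing

/-! ### Positivity and L₁ bounds for powers of resolvents and their adjoints. -/

namespace C0Semigroup

variable {Ω : Type*} [MeasurableSpace Ω] {m : Measure Ω} {T : C0Semigroup (Lp ℝ 2 m)}
  {μ ω M : ℝ}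

theorem IsPositive.resolventOp_pow_nonneg (hT : T.IsPositive)
    (hR : Set.Ici μ ⊆ T.generator.realResolventSet) (n : ℕ) {u : Lp ℝ 2 m} (hu : 0 ≤ u) :
    0 ≤ (T.generator.resolventOp μ ^ n) u := by
  refine L2.nonneg_of_forall_inner_nonneg fun s hs hm => ?_
  set e := indicatorConstLp 2 hs hm (1 : ℝ)
  -- Positivity is an orbit bound with c = 0, valid at every exponential rate; μ - 1 is just some
  -- rate below μ.
  have h1 : T.OrbitBound (-innerSL ℝ e) (μ - 1) 0 u := fun t => by
    have := L2.inner_nonneg_of_nonneg (indicatorConstLp_one_nonneg hs hm) (hT t u hu)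
    simpa using this
  have h2 := h1.apply_resolventOp_pow_le (sub_one_lt μ) hR n
  rw [real_inner_comm]
  simpa using h2

theorem IsPositive.adjoint_resolventOp_pow_nonneg (hT : T.IsPositive)
    (hR : Set.Ici μ ⊆ T.generator.realResolventSet) (n : ℕ) {v : Lp ℝ 2 m} (hv : 0 ≤ v) :
    0 ≤ ContinuousLinearMap.adjoint (T.generator.resolventOp μ ^ n) v := by
  refine L2.nonneg_of_forall_inner_nonneg fun s hs hm => ?_
  rw [ContinuousLinearMap.adjoint_inner_left]
  exact L2.inner_nonneg_of_nonneg hv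
    (hT.resolventOp_pow_nonneg hR n (indicatorConstLp_one_nonneg hs hm))

theorem IsPositive.integrable_resolventOp_pow (hT : T.IsPositive) (hTb : ExpBoundedOnL1 T.op M ω)
    (hμ : ω < μ) (hR : Set.Ici μ ⊆ T.generator.realResolventSet) (n : ℕ) {u : Lp ℝ 2 m}
    (hu : 0 ≤ u) (hui : Integrable u m) :
    Integrable ((T.generator.resolventOp μ ^ n) u) m ∧
      l1Norm ((T.generator.resolventOp μ ^ n) u) ≤ M * l1Norm u / (μ - ω) ^ n := by
  refine L2.integrable_of_forall_inner_le (hT.resolventOp_pow_nonneg hR n hu) fun s hs hm => ?_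
  have h1 : T.OrbitBound (innerSL ℝ (indicatorConstLp 2 hs hm (1 : ℝ))) ω (M * l1Norm u) u := by
    intro t
    obtain ⟨h2, h3⟩ := hTb t u hui
    rw [innerSL_apply_apply, real_inner_comm]
    calc _ ≤ l1Norm (T.op t u) := L2.inner_indicator_one_le_l1Norm hs hm h2
      _ ≤ _ := h3
      _ = _ := by ring
  rw [real_inner_comm]
  exact h1.apply_resolventOp_pow_le hμ hR n

/-- As ⟨v, T(t)1_s⟩ = ⟨T(t)*v, 1_s⟩, the L₁ bound for the adjoints is an orbit bound for T itself,
started at 1_s; no theory of the adjoint semigroup is required. -/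
theorem IsPositive.integrable_adjoint_resolventOp_pow (hT : T.IsPositive)
    (hTb : ExpBoundedOnL1 (fun t => ContinuousLinearMap.adjoint (T.op t)) M ω)
    (hμ : ω < μ) (hR : Set.Ici μ ⊆ T.generator.realResolventSet) (n : ℕ) {v : Lp ℝ 2 m}
    (hv : 0 ≤ v) (hvi : Integrable v m) :
    Integrable (ContinuousLinearMap.adjoint (T.generator.resolventOp μ ^ n) v) m ∧
      l1Norm (ContinuousLinearMap.adjoint (T.generator.resolventOp μ ^ n) v)
        ≤ M * l1Norm v / (μ - ω) ^ n := by
  refine L2.integrable_of_forall_inner_le (hT.adjoint_resolventOp_pow_nonneg hR n hv)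
    fun s hs hm => ?_
  have h1 : T.OrbitBound (innerSL ℝ v) ω (M * l1Norm v) (indicatorConstLp 2 hs hm (1 : ℝ)) := by
    intro t
    obtain ⟨h2, h3⟩ := hTb t v hvi
    rw [innerSL_apply_apply, ← ContinuousLinearMap.adjoint_inner_left]
    calc _ ≤ l1Norm (ContinuousLinearMap.adjoint (T.op t) v) :=
          L2.inner_indicator_one_le_l1Norm hs hm h2
      _ ≤ _ := h3
      _ = _ := by ring
  rw [ContinuousLinearMap.adjoint_inner_left]
  exact h1.apply_resolventOp_pow_le hμ hR n

end C0Semigroup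

/-! ### The adjoint of the generator. -/

namespace C0Semigroup

section Hilbert

variable {H : Type*} [NormedAddCommGroup H] [InnerProductSpace ℝ H] [CompleteSpace H]
  (T : C0Semigroup H)

theorem inner_generator_left (x : T.generator.domain) (v : T.generator.adjoint.domain) :
    ⟪T.generator x, (v : H)⟫_ℝ = ⟪(x : H), T.generator.adjoint v⟫_ℝ := by
  have := LinearPMap.adjoint_isFormalAdjoint T.dense_domain v x
  rw [real_inner_comm, ← this, real_inner_comm]

/-- The adjoint of the generator is a weak derivative of the orbits at `0`. -/
theorem tendsto_inner_adjoint (u : H) (v : T.generator.adjoint.domain) :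
    Tendsto (fun t : ℝ≥0 => (t : ℝ)⁻¹ * (⟪T.op t u, (v : H)⟫_ℝ - ⟪u, (v : H)⟫_ℝ)) (𝓝[>] 0)
      (𝓝 ⟪u, T.generator.adjoint v⟫_ℝ) := by
  have h3 : HasDerivAt (fun t => T.truncLaplace 0 t u) u 0 := by
    simpa [discounted, T.op_zero_apply] using T.hasDerivAt_truncLaplace 0 0 u
  have h4 := (h3.tendsto_slope_zero_right.comp tendsto_coe_nhdsGT_zero).inner
    (𝕜 := ℝ) (tendsto_const_nhds (x := T.generator.adjoint v))
  refine h4.congr fun t => ?_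
  have h0 : T.truncLaplace 0 0 u = 0 := by simp [truncLaplace_apply]
  -- The vector u need not lie in D(A), but T(t)u - u = A ∫₀ᵗ T(s)u ds, and A can be moved onto v.
  obtain ⟨h5, h6⟩ := T.truncLaplace_mem_domain 0 t.coe_nonneg u
  have h7 := T.inner_generator_left ⟨_, h5⟩ v
  rw [h6, zero_smul, zero_add, inner_sub_left] at h7
  have h8 : T.discounted 0 u t = T.op t u := by simp [discounted]
  rw [h8] at h7
  simp only [Function.comp_apply, zero_add, h0, sub_zero, real_inner_smul_left]
  rw [h7]

/-- Pair with x in D(A) and use μRx - x = RAx. This supplies the test vectors R*v in D(A*). -/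
theorem adjoint_resolventOp_mem_domain {μ : ℝ} (hμ : μ ∈ T.generator.realResolventSet) (v : H) :
    ∃ h : ContinuousLinearMap.adjoint (T.generator.resolventOp μ) v ∈ T.generator.adjoint.domain,
      T.generator.adjoint ⟨_, h⟩
        = μ • ContinuousLinearMap.adjoint (T.generator.resolventOp μ) v - v := by
  set w := ContinuousLinearMap.adjoint (T.generator.resolventOp μ) v with hw
  have key : ∀ x : T.generator.domain, ⟪μ • w - v, (x : H)⟫_ℝ = ⟪w, T.generator x⟫_ℝ := by
    intro x
    rw [hw, ContinuousLinearMap.adjoint_inner_left,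
      ← (T.generator.resolventOp_spec hμ).smul_sub_self x, inner_sub_left, inner_sub_right,
      real_inner_smul_left, real_inner_smul_right, ContinuousLinearMap.adjoint_inner_left]
  have hmem := LinearPMap.mem_adjoint_domain_of_exists (T := T.generator) w ⟨_, key⟩
  exact ⟨hmem, LinearPMap.adjoint_apply_eq T.dense_domain ⟨w, hmem⟩ key⟩

end Hilbert

end C0Semigroup

/-! ### The implications between the three bounds. -/

section Domination

variable {Ω : Type*} [MeasurableSpace Ω] {m : Measure Ω} {T T₀ : C0Semigroup (Lp ℝ 2 m)}
  {M ω C C' : ℝ}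

theorem GeneratorBound.mono (h : GeneratorBound T T₀ C) (hC : C ≤ C') :
    GeneratorBound T T₀ C' := fun u v hu hui hv hvi => by
  refine (h u v hu hui hv hvi).trans ?_
  have := l1Norm_nonneg (u : Lp ℝ 2 m)
  have := l1Norm_nonneg (v : Lp ℝ 2 m)
  gcongr

theorem ResolventBound.mono (h : ResolventBound T T₀ ω C) (hC : C ≤ C') :
    ResolventBound T T₀ ω C' := fun μ hμ hR u hu hui => by
  filter_upwards [h μ hμ hR u hu hui] with x hx
  refine hx.trans ?_
  have := l1Norm_nonneg u
  gcongr

/-- Subtract ⟨u, v⟩, divide by t and let t ↓ 0. The left side converges as u ∈ D(A); on the right v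
∈ D(A₀*) gives weak differentiability without u ∈ D(A₀). -/
theorem SemigroupBound.generatorBound (h : SemigroupBound T T₀ ω C) : GeneratorBound T T₀ C := by
  intro u v hu hui hv hvi
  have h1 := ((T.tendsto_generator u).inner (𝕜 := ℝ) (tendsto_const_nhds (x := (v : Lp ℝ 2 m))))
  have h2 : Tendsto (fun t : ℝ≥0 => C * Real.exp (ω * t) * l1Norm (u : Lp ℝ 2 m)
      * l1Norm (v : Lp ℝ 2 m)) (𝓝[>] 0)
      (𝓝 (C * l1Norm (u : Lp ℝ 2 m) * l1Norm (v : Lp ℝ 2 m))) := by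
    have hc : Continuous fun t : ℝ≥0 => C * Real.exp (ω * t) * l1Norm (u : Lp ℝ 2 m)
      * l1Norm (v : Lp ℝ 2 m) := by fun_prop
    simpa using (hc.tendsto 0).mono_left nhdsWithin_le_nhds
  refine le_of_tendsto_of_tendsto h1 ((T₀.tendsto_inner_adjoint u v).add h2) ?_
  filter_upwards [self_mem_nhdsWithin] with t ht
  have ht' : (0 : ℝ) < t := by exact_mod_cast ht
  have h3 := L2.inner_le_of_ae_le hv hvi (h t u hu hui)
  rw [real_inner_smul_left, inner_sub_left]
  have h4 : C * Real.exp (ω * t) * l1Norm (u : Lp ℝ 2 m) * l1Norm (v : Lp ℝ 2 m)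
      = (t : ℝ)⁻¹ * (C * t * Real.exp (ω * t) * l1Norm (u : Lp ℝ 2 m)
        * l1Norm (v : Lp ℝ 2 m)) := by
    field_simp
  rw [h4, ← mul_add]
  refine mul_le_mul_of_nonneg_left ?_ (inv_nonneg.2 ht'.le)
  linarith

theorem GeneratorBound.resolventBound (hT : T.IsPositive) (hT₀ : T₀.IsPositive)
    (hTb : ExpBoundedOnL1 T.op M ω)
    (hT₀b : ExpBoundedOnL1 (fun t => ContinuousLinearMap.adjoint (T₀.op t)) M ω)
    (hC : 0 ≤ C) (h : GeneratorBound T T₀ C) : ResolventBound T T₀ ω (C * M ^ 2) := by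
  intro μ hμ hR u hu hui
  have hRT : Set.Ici μ ⊆ T.generator.realResolventSet := fun x hx => (hR hx).1
  have hRT₀ : Set.Ici μ ⊆ T₀.generator.realResolventSet := fun x hx => (hR hx).2
  have hμ' : 0 < μ - ω := by linarith
  have hu1 := l1Norm_nonneg u
  refine L2.ae_le_add_of_forall_inner_le (by positivity) fun s hs hm => ?_
  set v := indicatorConstLp 2 hs hm (1 : ℝ)
  have hv : 0 ≤ v := indicatorConstLp_one_nonneg hs hm
  have hvi : Integrable v m := integrable_indicatorConstLp_one hs hm
  rw [show m.real s = l1Norm v from (l1Norm_indicatorConstLp_one hs hm).symm]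
  obtain ⟨h1, h2⟩ := (T.generator.resolventOp_spec (hRT Set.self_mem_Ici)).1 u
  obtain ⟨h3, h4⟩ := T₀.adjoint_resolventOp_mem_domain (hRT₀ Set.self_mem_Ici) v
  have h5 := hT.integrable_resolventOp_pow hTb hμ hRT 1 hu hui
  have h6 := hT₀.integrable_adjoint_resolventOp_pow hT₀b hμ hRT₀ 1 hv hvi
  have h7 := hT.resolventOp_pow_nonneg hRT 1 hu
  have h8 := hT₀.adjoint_resolventOp_pow_nonneg hRT₀ 1 hv
  rw [pow_one] at h5 h6 h7 h8
  -- Apply the bound to Ru and S*v. As ARu = μRu - u and A₀*S*v = μS*v - v, the μ-terms cancel and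
  -- ⟨Ru, v⟩ - ⟨Su, v⟩ is left.
  have h9 := h ⟨_, h1⟩ ⟨_, h3⟩ h7 h5.1 h8 h6.1
  have h10 : T.generator ⟨_, h1⟩ = μ • T.generator.resolventOp μ u - u := by
    exact (sub_eq_of_eq_add' (sub_eq_iff_eq_add.1 h2)).symm
  have h11 : C * l1Norm (T.generator.resolventOp μ u)
      * l1Norm (ContinuousLinearMap.adjoint (T₀.generator.resolventOp μ) v)
      ≤ C * (M * l1Norm u / (μ - ω)) * (M * l1Norm v / (μ - ω)) := by
    have h12 := h5.2
    have h13 := h6.2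
    rw [pow_one] at h12 h13
    have h14 := (l1Norm_nonneg _).trans h12
    have := l1Norm_nonneg (ContinuousLinearMap.adjoint (T₀.generator.resolventOp μ) v)
    gcongr
  have h12 : C * (M * l1Norm u / (μ - ω)) * (M * l1Norm v / (μ - ω))
      = C * M ^ 2 / (μ - ω) ^ 2 * l1Norm u * l1Norm v := by
    field_simp
  rw [h10, h4] at h9
  simp only [ContinuousLinearMap.adjoint_inner_right, map_sub, map_smul, inner_sub_left,
    inner_sub_right, real_inner_smul_left, real_inner_smul_right] at h9
  linarith

/-- In this order of factors the powers of R act on u and those of S can be moved to the test vector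
as adjoints, matching the L₁ hypotheses on T and T₀*. -/
theorem pow_apply_sub_pow_apply {E : Type*} [NormedAddCommGroup E] [NormedSpace ℝ E]
    (R S : E →L[ℝ] E) (n : ℕ) (u : E) :
    (R ^ n) u - (S ^ n) u
      = ∑ k ∈ Finset.range n, (S ^ (n - 1 - k)) (R ((R ^ k) u) - S ((R ^ k) u)) := by
  induction n with
  | zero => simp
  | succ n ih =>
    have h1 : (R ^ (n + 1)) u - (S ^ (n + 1)) u
        = S ((R ^ n) u - (S ^ n) u) + (R ((R ^ n) u) - S ((R ^ n) u)) := by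
      rw [pow_succ' R, pow_succ' S, map_sub]
      change R ((R ^ n) u) - S ((S ^ n) u) = _
      abel
    rw [h1, ih, Finset.sum_range_succ, map_sum]
    congr 1
    · refine Finset.sum_congr rfl fun k hk => ?_
      rw [Finset.mem_range] at hk
      have : n + 1 - 1 - k = (n - 1 - k) + 1 := by omega
      rw [this, pow_succ' S]
      rfl
    · simp

/-- Powers of the resolvents, by telescoping. -/
theorem ResolventBound.inner_pow_le (hT : T.IsPositive) (hT₀ : T₀.IsPositive)
    (hTb : ExpBoundedOnL1 T.op M ω)
    (hT₀b : ExpBoundedOnL1 (fun t => ContinuousLinearMap.adjoint (T₀.op t)) M ω)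
    (hC : 0 ≤ C) (h : ResolventBound T T₀ ω C) {μ : ℝ} (hμ : ω < μ)
    (hR : Set.Ici μ ⊆ T.generator.realResolventSet ∩ T₀.generator.realResolventSet)
    {u v : Lp ℝ 2 m} (hu : 0 ≤ u) (hui : Integrable u m) (hv : 0 ≤ v) (hvi : Integrable v m)
    (n : ℕ) :
    ⟪(T.generator.resolventOp μ ^ n) u, v⟫_ℝ ≤ ⟪(T₀.generator.resolventOp μ ^ n) u, v⟫_ℝ
      + n * (C * M ^ 2 * l1Norm u * l1Norm v / (μ - ω) ^ (n + 1)) := by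
  have hRT : Set.Ici μ ⊆ T.generator.realResolventSet := fun x hx => (hR hx).1
  have hRT₀ : Set.Ici μ ⊆ T₀.generator.realResolventSet := fun x hx => (hR hx).2
  have hμ' : 0 < μ - ω := by linarith
  rw [← sub_le_iff_le_add', ← inner_sub_left, pow_apply_sub_pow_apply, sum_inner]
  refine (Finset.sum_le_card_nsmul _ _
    (C * M ^ 2 * l1Norm u * l1Norm v / (μ - ω) ^ (n + 1)) fun k hk => ?_).trans (by simp)
  rw [Finset.mem_range] at hk
  obtain ⟨h1, h2⟩ := hT.integrable_resolventOp_pow hTb hμ hRT k hu hui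
  obtain ⟨h3, h4⟩ := hT₀.integrable_adjoint_resolventOp_pow hT₀b hμ hRT₀ (n - 1 - k) hv hvi
  have h5 := hT.resolventOp_pow_nonneg hRT k hu
  have h6 := hT₀.adjoint_resolventOp_pow_nonneg hRT₀ (n - 1 - k) hv
  have h7 := L2.inner_le_of_ae_le h6 h3 (h μ hμ hR _ h5 h1)
  rw [← ContinuousLinearMap.adjoint_inner_right, inner_sub_left, sub_le_iff_le_add']
  refine h7.trans ?_
  have h8 := l1Norm_nonneg
    (ContinuousLinearMap.adjoint (T₀.generator.resolventOp μ ^ (n - 1 - k)) v)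
  have h9 := (l1Norm_nonneg _).trans h2
  have hpow : (μ - ω) ^ (n + 1) = (μ - ω) ^ 2 * (μ - ω) ^ k * (μ - ω) ^ (n - 1 - k) := by
    rw [← pow_add, ← pow_add]
    congr 1
    omega
  have h10 : C * M ^ 2 * l1Norm u * l1Norm v / (μ - ω) ^ (n + 1)
      = C / (μ - ω) ^ 2 * (M * l1Norm u / (μ - ω) ^ k)
        * (M * l1Norm v / (μ - ω) ^ (n - 1 - k)) := by
    rw [hpow]
    field_simp
  rw [h10]
  gcongr

/-- Since n/t - ω = (n/t)(1 - ωt/n), the expression is t (1 - ωt/n)^{-(n+1)}. -/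
theorem tendsto_pow_div_sub_pow {ω t : ℝ} (ht : 0 < t) :
    Tendsto (fun n : ℕ => (n / t) ^ n * (n / (n / t - ω) ^ (n + 1))) atTop
      (𝓝 (t * Real.exp (ω * t))) := by
  have h1 : Tendsto (fun n : ℕ => (1 + (-(ω * t)) / n) ^ n) atTop (𝓝 (Real.exp (-(ω * t)))) :=
    Real.tendsto_one_add_div_pow_exp _
  have h2 : Tendsto (fun n : ℕ => 1 + (-(ω * t)) / (n : ℝ)) atTop (𝓝 1) := by
    simpa using (tendsto_const_div_atTop_nhds_zero_nat (-(ω * t))).const_add 1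
  have h3 := ((h1.mul h2).inv₀ (by positivity)).const_mul t
  rw [mul_one, ← Real.exp_neg, neg_neg] at h3
  refine h3.congr' ?_
  filter_upwards [eventually_gt_atTop 0] with n hn
  have hn' : (0 : ℝ) < n := by exact_mod_cast hn
  have h4 : n / t - ω = n / t * (1 + (-(ω * t)) / n) := by
    field_simp
    ring
  rw [h4, mul_pow, ← pow_succ, pow_succ (n / t)]
  field_simp

theorem ResolventBound.semigroupBound (hT : T.IsPositive) (hT₀ : T₀.IsPositive)
    (hTb : ExpBoundedOnL1 T.op M ω)
    (hT₀b : ExpBoundedOnL1 (fun t => ContinuousLinearMap.adjoint (T₀.op t)) M ω)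
    (hC : 0 ≤ C) (h : ResolventBound T T₀ ω C) : SemigroupBound T T₀ ω (C * M ^ 2) := by
  intro t u hu hui
  rcases eq_zero_or_pos t with rfl | ht
  · simp [C0Semigroup.op_zero_apply]
  have ht' : (0 : ℝ) < t := by exact_mod_cast ht
  have hu1 := l1Norm_nonneg u
  refine L2.ae_le_add_of_forall_inner_le (by positivity) fun s hs hm => ?_
  set v := indicatorConstLp 2 hs hm (1 : ℝ)
  have hv : 0 ≤ v := indicatorConstLp_one_nonneg hs hm
  have hvi : Integrable v m := integrable_indicatorConstLp_one hs hm
  rw [show m.real s = l1Norm v from (l1Norm_indicatorConstLp_one hs hm).symm]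
  obtain ⟨a, ha⟩ := T.exists_Ici_subset_realResolventSet
  obtain ⟨a₀, ha₀⟩ := T₀.exists_Ici_subset_realResolventSet
  have hμ : Tendsto (fun n : ℕ => (n / t : ℝ)) atTop atTop :=
    tendsto_natCast_atTop_atTop.atTop_div_const ht'
  have h1 := (T.tendsto_resolventOp_pow ht u).inner (𝕜 := ℝ) (tendsto_const_nhds (x := v))
  have h2 := (T₀.tendsto_resolventOp_pow ht u).inner (𝕜 := ℝ) (tendsto_const_nhds (x := v))
  have h3 := (tendsto_pow_div_sub_pow (ω := ω) ht').const_mul (C * M ^ 2 * l1Norm u * l1Norm v)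
  have h4 := le_of_tendsto_of_tendsto h1 (h2.add h3) ?_
  · refine h4.trans_eq ?_
    ring
  filter_upwards [hμ.eventually_ge_atTop a, hμ.eventually_ge_atTop a₀, hμ.eventually_gt_atTop ω]
    with n hn1 hn2 hn3
  have h5 := h.inner_pow_le hT hT₀ hTb hT₀b hC hn3 (Set.subset_inter
    ((Set.Ici_subset_Ici.2 hn1).trans ha) ((Set.Ici_subset_Ici.2 hn2).trans ha₀))
    hu hui hv hvi n
  rw [real_inner_smul_left, real_inner_smul_left]
  calc _ ≤ (n / t : ℝ) ^ n * (_ + _) := mul_le_mul_of_nonneg_left h5 (by positivity)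
    _ = _ := by ring

end Domination

theorem theorem2p1 {Ω : Type*} [MeasurableSpace Ω] (m : Measure Ω)
    (T T₀ : C0Semigroup (Lp ℝ 2 m)) (hT : T.IsPositive) (hT₀ : T₀.IsPositive)
    (M ω : ℝ) (hM : 1 ≤ M)
    (hTb : ExpBoundedOnL1 T.op M ω)
    (hT₀b : ExpBoundedOnL1 (fun t => ContinuousLinearMap.adjoint (T₀.op t)) M ω) :
    List.TFAE [
      ∃ C₁ : ℝ, SemigroupBound T T₀ ω C₁,
      ∃ C₂ : ℝ, GeneratorBound T T₀ C₂,
      ∃ C₃ : ℝ, ResolventBound T T₀ ω C₃] ∧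
    (∀ C : ℝ, SemigroupBound T T₀ ω C → GeneratorBound T T₀ C) ∧
    (∀ C : ℝ, 0 ≤ C → GeneratorBound T T₀ C → ResolventBound T T₀ ω (C * M ^ 2)) ∧
    (∀ C : ℝ, 0 ≤ C → ResolventBound T T₀ ω C → SemigroupBound T T₀ ω (C * M ^ 2)) := by
  refine ⟨?_, fun C h => h.generatorBound, fun C hC h => h.resolventBound hT hT₀ hTb hT₀b hC,
    fun C hC h => h.semigroupBound hT hT₀ hTb hT₀b hC⟩
  tfae_have 1 → 2 := fun ⟨C, h⟩ => ⟨C, h.generatorBound⟩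
  -- The quantitative implication is for C ≥ 0; enlarging C to max C 0 weakens the bound harmlessly.
  tfae_have 2 → 3 := fun ⟨C, h⟩ => ⟨max C 0 * M ^ 2,
    (h.mono (le_max_left C 0)).resolventBound hT hT₀ hTb hT₀b (le_max_right C 0)⟩
  tfae_have 3 → 1 := fun ⟨C, h⟩ => ⟨max C 0 * M ^ 2,
    (h.mono (le_max_left C 0)).semigroupBound hT hT₀ hTb hT₀b (le_max_right C 0)⟩
  tfae_finish
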